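/- **Setting.** Let $f:\mathbb R^D\times[0,T]\to\mathbb R^D$ ($T>0$) be of class $C^2$, let $z:[0,T]\to\mathbb R^D$ satisfy $z'(t)=f(z(t),t)$, and let $A_t=\frac{\partial f}{\partial z}(z(t),t)\in\mathbb R^{D\times D}$. Assume that $A_t$ is symmetric positive semidefinite for every $t\in[0,T]$. Let $q$ be the initial density, with $q(z(0))>0$. The neural-ODE log-likelihood is $$\log p_\theta(z(t))=\log q(z(0))-\int_0^t \mathrm{Tr}(A_s)\,ds .$$ Let $m>3$ be a multiple of $3$, and let $S_1,\dots,S_{m/3},G_1,\dots,G_{m/3}$ be independent standard Gaussian vectors in $\mathbb R^D$, drawn once and used at all times. For a matrix $B$ let $H_{m/3}(B)=\frac{3}{m}\sum_{i=1}^{m/3}G_i^\top BG_i$, and let $\mathrm{QR}(B)$ be a matrix whose nonzero columns form the orthonormal basis of the range of $B$ obtained by Gram–Schmidt from the columns of $B$. Let $L\ge1$, $L_s\ge 1$ be integers and $\eta=T/L$. The factor $Q_t$ is updated every $L_s$ steps of length $\eta$: $Q_t=\mathrm{QR}(A_{\tau(t)}S)$, where $S=(S_1,\dots,S_{m/3})$.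 For $L_s\ge2$, $\tau(t)=\big\lfloor \tfrac{t}{L_s\eta}\big\rfloor L_s\eta$ for $t<T$ and $\tau(T)=T$; for $L_s=1$ (no reuse of the factor), $\tau(t)=t$. The frozen-QR approximate Hutch++ estimator of $\mathrm{Tr}(A_t)$ is $$\widetilde H_t=\mathrm{Tr}(Q_t^\top A_tQ_t)+H_{m/3}\big((I-Q_tQ_t^\top)A_t(I-Q_tQ_t^\top)\big),$$ and the estimated log-likelihood is $\log\tilde p_\theta(t)=\log q(z(0))-\int_0^t\widetilde H_s\,ds$. **Proposition 5.5 (log-likelihood error propagation).** The map $t\mapsto A_t$ is Lipschitz on $[0,T]$ in the Frobenius norm, and the maximum $M=\max_{t\in[0,T]}|\mathrm{Tr}(A_t)|$ exists. There is an absolute constant $C\ge0$ such that in every such setting, for every Lipschitz constant $K$ of $t\mapsto A_t$ and every $t\in[0,T]$, the integral defining $\log\tilde p_\theta(t)$ exists for every realization of the vectors, $\log\tilde p_\theta(t)$ is square-integrable, and $$\mathbb E[\log\tilde p_\theta(t)]=\log p_\theta(z(t)),\qquad \mathrm{Var}[\log\tilde p_\theta(t)]\le T^2\left[\frac{36M^2}{m(m-3)}+\frac1m\,C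 K^2 (L_s-1)^2\eta^2\right].$$ -/

import Mathlib

open MeasureTheory ProbabilityTheory Set
open scoped NNReal Matrix

-- Matrices carry the Frobenius norm.
attribute [local instance] Matrix.frobeniusNormedAddCommGroup

namespace NeuralODE

noncomputable section

/-- The Jacobian matrix `A_t = (∂f_i/∂z_j)(z(t), t)` of the velocity field along a trajectory. -/
def jacobian {D : ℕ} (f : EuclideanSpace ℝ (Fin D) → ℝ → EuclideanSpace ℝ (Fin D))
    (z : ℝ → EuclideanSpace ℝ (Fin D)) (t : ℝ) : Matrix (Fin D) (Fin D) ℝ :=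
  Matrix.of fun i j => (fderiv ℝ (fun x => f x t) (z t)) (EuclideanSpace.single j 1) i

/-- The neural-ODE log-likelihood
`log p_θ(z(t)) = log q(z(0)) - ∫₀ᵗ Tr (∂f/∂z)(z(s), s) ds`. -/
def logLikelihood {D : ℕ} (f : EuclideanSpace ℝ (Fin D) → ℝ → EuclideanSpace ℝ (Fin D))
    (q : EuclideanSpace ℝ (Fin D) → ℝ) (z : ℝ → EuclideanSpace ℝ (Fin D)) (t : ℝ) : ℝ :=
  Real.log (q (z 0)) - ∫ s in (0 : ℝ)..t, (jacobian f z s).trace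

/-- The Hutchinson estimator `H_n(B) = (1/n) ∑ᵢ vᵢᵀ B vᵢ`. -/
def hutchinson {D n : ℕ} (v : Fin n → EuclideanSpace ℝ (Fin D))
    (B : Matrix (Fin D) (Fin D) ℝ) : ℝ :=
  (1 / (n : ℝ)) * ∑ i, (v i).ofLp ⬝ᵥ (B *ᵥ (v i).ofLp)

/-- The factor `Q = QR(A S)`: its columns come from the Gram–Schmidt orthonormalization of the
columns `A S₁, …, A Sₙ`. A column that depends linearly on the previous ones contributes a zero
column, so the nonzero columns of `Q` are always an orthonormal basis of the range of `A S`, and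
`Q Qᵀ` is the orthogonal projection onto that range. -/
def qrFactor {D n : ℕ} (A : Matrix (Fin D) (Fin D) ℝ)
    (S : Fin n → EuclideanSpace ℝ (Fin D)) : Matrix (Fin D) (Fin n) ℝ :=
  Matrix.of fun i j =>
    InnerProductSpace.gramSchmidtNormed ℝ (fun l => WithLp.toLp 2 (A *ᵥ (S l).ofLp)) j i

/-- The approximate Hutch++ estimator of `Tr A'`, with `Q = QR(A S)` computed from another
matrix `A`: `Tr(Qᵀ A' Q) + H_n((I - Q Qᵀ) A' (I - Q Qᵀ))`. -/
def approxHutchPP {D n : ℕ} (A A' : Matrix (Fin D) (Fin D) ℝ)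
    (S G : Fin n → EuclideanSpace ℝ (Fin D)) : ℝ :=
  ((qrFactor A S)ᵀ * A' * qrFactor A S).trace +
    hutchinson G ((1 - qrFactor A S * (qrFactor A S)ᵀ) * A' *
      (1 - qrFactor A S * (qrFactor A S)ᵀ))

open Classical in
/-- The time at which the `Q` in use at time `t` was computed, for a grid of `[0, T]` with step
`η` and an update every `Ls` steps. For `Ls = 1` there is no reuse: `Q` is always current.
For `Ls ≥ 2` it is the beginning `⌊t / (Ls η)⌋ Ls η` of the current block of `Ls` steps
(and the final time itself at the final time). -/
def updateTime (T η : ℝ) (Ls : ℕ) (t : ℝ) : ℝ :=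
  if Ls = 1 ∨ t = T then t else (⌊t / (Ls * η)⌋₊ : ℝ) * (Ls * η)

/-- The frozen-QR estimate of `Tr A_t`; the sketching vectors `S` and the probe vectors `G` are
the same at all times. -/
def frozenTrace {D n : ℕ} (f : EuclideanSpace ℝ (Fin D) → ℝ → EuclideanSpace ℝ (Fin D))
    (z : ℝ → EuclideanSpace ℝ (Fin D)) (T η : ℝ) (Ls : ℕ)
    (S G : Fin n → EuclideanSpace ℝ (Fin D)) (t : ℝ) : ℝ :=
  approxHutchPP (jacobian f z (updateTime T η Ls t)) (jacobian f z t) S G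

/-- The estimated log-likelihood `log p̃_θ(t)`. -/
def estLogLikelihood {D n : ℕ} (f : EuclideanSpace ℝ (Fin D) → ℝ → EuclideanSpace ℝ (Fin D))
    (q : EuclideanSpace ℝ (Fin D) → ℝ) (z : ℝ → EuclideanSpace ℝ (Fin D)) (T η : ℝ) (Ls : ℕ)
    (S G : Fin n → EuclideanSpace ℝ (Fin D)) (t : ℝ) : ℝ :=
  Real.log (q (z 0)) - ∫ s in (0 : ℝ)..t, frozenTrace f z T η Ls S G s

end

end NeuralODE

/-! Fix the old Jacobian `A`, the current one `B`, and put `n = m/3`, `P = QQᵀ`. Since `P` is an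
orthogonal projection, `Tr(QᵀBQ) + Tr((I-P)B(I-P)) = Tr B`, so the error of the estimator is the
Hutchinson error of `R = (I-P)B(I-P)`. Given `S` it is centred with variance `(2/n)‖R‖²`, and `‖R‖ ≤
‖(I-P)A‖ + ‖B-A‖`. The second term is at most `K` times the age of the factor. The first is a
randomized range-finder error, and the core of the proof is `lintegral_norm_one_sub_mul_sq_le`:
`E‖(I-P)A‖² ≤ (Tr A)²/(n-1)` for positive semidefinite `A`, whatever its rank.

For that bound, choose a set `t` of `k` eigenindices of `A`. For `i ∈ t`, a combination of the
sketch vectors agrees with the eigenvector `bᵢ` on all coordinates in `t`; its other coordinates are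
`⟪Wⱼ,u⟫/‖u‖²`, where the `Wⱼ` are the Gaussian coordinate rows of `S` and `u` is the part of `Wᵢ`
orthogonal to the other rows of `t`. Independence of the rows and `E[1/χ²_d] = 1/(d-2)` give the
factor `1 + k/(n-k-1)` times the tail `∑_{j∉t} λⱼ²`. Taking for `t` the eigenvalues above `Tr
A/(n-1)` makes the product collapse to `(Tr A)²/(n-1)`.

The errors at different times are dependent, since the vectors are shared. Cauchy–Schwarz in time
and Fubini (`memLp_intervalIntegral`) still carry the uniform pointwise bound to the integral, at
the price of a factor `t²`. -/

/-! ### Frobenius norm and orthogonal projections. -/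

open Module in
theorem OrthonormalBasis.sum_norm_sq_eq {ι κ E F : Type*} [Fintype ι] [Fintype κ]
    [NormedAddCommGroup E] [InnerProductSpace ℝ E] [FiniteDimensional ℝ E]
    [NormedAddCommGroup F] [InnerProductSpace ℝ F] [FiniteDimensional ℝ F]
    (b : OrthonormalBasis ι ℝ E) (c : OrthonormalBasis κ ℝ F) (T : E →ₗ[ℝ] F) :
    ∑ i, ‖T (b i)‖ ^ 2 = ∑ j, ‖T.adjoint (c j)‖ ^ 2 := by
  have h1 : ∀ i, ‖T (b i)‖ ^ 2 = ∑ j, inner ℝ (c j) (T (b i)) ^ 2 := fun i =>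
    (c.sum_sq_inner_right (T (b i))).symm
  have h2 : ∀ j, ‖T.adjoint (c j)‖ ^ 2 = ∑ i, inner ℝ (b i) (T.adjoint (c j)) ^ 2 := fun j =>
    (b.sum_sq_inner_right _).symm
  simp_rw [h1, h2]
  rw [Finset.sum_comm]
  refine Finset.sum_congr rfl fun j _ => Finset.sum_congr rfl fun i _ => ?_
  rw [LinearMap.adjoint_inner_right, real_inner_comm]

namespace NeuralODE

open InnerProductSpace Submodule

theorem norm_sq_eq_sum {m n : Type*} [Fintype m] [Fintype n] (B : Matrix m n ℝ) :
    ‖B‖ ^ 2 = ∑ i, ∑ j, B i j ^ 2 := by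
  rw [Matrix.frobenius_norm_def, ← Real.sqrt_eq_rpow, Real.sq_sqrt]
  · simp
  · positivity

/-- The Hilbert–Schmidt norm does not depend on the basis. It will be used in an eigenbasis of the
matrix. -/
theorem norm_sq_eq_sum_basis {D : ℕ} {ι : Type*} [Fintype ι] (B : Matrix (Fin D) (Fin D) ℝ)
    (b : OrthonormalBasis ι ℝ (EuclideanSpace ℝ (Fin D))) :
    ‖B‖ ^ 2 = ∑ i, ‖Matrix.toEuclideanLin B (b i)‖ ^ 2 := by
  rw [b.sum_norm_sq_eq b, ← (EuclideanSpace.basisFun (Fin D) ℝ).sum_norm_sq_eq b, norm_sq_eq_sum,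
    Finset.sum_comm]
  refine Finset.sum_congr rfl fun j _ => ?_
  rw [EuclideanSpace.real_norm_sq_eq]
  simp [Matrix.toLpLin_apply]

theorem starProjection_span_eq_sum {E : Type*} [NormedAddCommGroup E] [InnerProductSpace ℝ E]
    [FiniteDimensional ℝ E] {n : ℕ} (v : Fin n → E) (x : E) :
    (span ℝ (range v)).starProjection x =
      ∑ l, inner ℝ (gramSchmidtNormed ℝ v l) x • gramSchmidtNormed ℝ v l := by
  refine eq_starProjection_of_mem_orthogonal ?_ ?_
  · refine sum_mem fun l _ => smul_mem _ _ ?_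
    rw [← span_gramSchmidt ℝ v, ← span_gramSchmidtNormed_range]
    exact subset_span (mem_range_self l)
  · rw [← span_gramSchmidt ℝ v, ← span_gramSchmidtNormed_range]
    rw [mem_orthogonal]
    intro u hu
    induction hu using span_induction with
    | mem u hu =>
      obtain ⟨m, rfl⟩ := hu
      rw [inner_sub_right, inner_sum]
      rw [Finset.sum_eq_single m]
      · rw [inner_smul_right, real_inner_self_eq_norm_sq]
        -- A vector dependent on its predecessors is normalized to zero and contributes nothing, so
        -- no independence assumption is needed.
        by_cases h : gramSchmidtNormed ℝ v m = 0
        · simp [h]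
        · rw [gramSchmidtNormed_unit_length' h]; simp
      · intro l _ hl
        have h : inner ℝ (gramSchmidtNormed ℝ v m) (gramSchmidtNormed ℝ v l) = 0 := by
          rw [gramSchmidtNormed, gramSchmidtNormed, inner_smul_left, inner_smul_right,
            gramSchmidt_orthogonal ℝ v hl.symm, mul_zero, mul_zero]
        rw [inner_smul_right, h, mul_zero]
      · simp
    | zero => simp
    | add u w _ _ hu hw => rw [inner_add_left, hu, hw, add_zero]
    | smul a u _ hu => rw [inner_smul_left, hu, mul_zero]

theorem norm_sub_starProjection_le {E : Type*} [NormedAddCommGroup E] [InnerProductSpace ℝ E]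
    (U : Submodule ℝ E) [U.HasOrthogonalProjection] (y : E) {w : E} (hw : w ∈ U) :
    ‖y - U.starProjection y‖ ≤ ‖y - w‖ := by
  rw [starProjection_minimal]
  exact ciInf_le ⟨0, by rintro _ ⟨_, rfl⟩; positivity⟩ (⟨w, hw⟩ : U)

/-! ### The projector `QQᵀ`. -/

section qr

variable {D n : ℕ} (A : Matrix (Fin D) (Fin D) ℝ) (S : Fin n → EuclideanSpace ℝ (Fin D))

theorem toEuclideanLin_qrFactor_mul_transpose (x : EuclideanSpace ℝ (Fin D)) :
    Matrix.toEuclideanLin (qrFactor A S * (qrFactor A S)ᵀ) x =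
      (span ℝ (range fun l => Matrix.toEuclideanLin A (S l))).starProjection x := by
  rw [starProjection_span_eq_sum]
  have hq : qrFactor A S = Matrix.of fun i l =>
    (gramSchmidtNormed ℝ (fun l => Matrix.toEuclideanLin A (S l)) l).ofLp i := rfl
  rw [hq]
  generalize gramSchmidtNormed ℝ (fun l => Matrix.toEuclideanLin A (S l)) = g
  ext i
  simp only [Matrix.toLpLin_apply, WithLp.ofLp_sum, WithLp.ofLp_smul, Finset.sum_apply,
    Pi.smul_apply, smul_eq_mul, Matrix.mulVec, dotProduct, Matrix.mul_apply,
    Matrix.of_apply, Matrix.transpose_apply, PiLp.inner_apply, RCLike.inner_apply, conj_trivial,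
    Finset.sum_mul]
  rw [Finset.sum_comm]
  refine Finset.sum_congr rfl fun l _ => Finset.sum_congr rfl fun j _ => ?_
  ring

theorem toEuclideanLin_one_sub_mul (B : Matrix (Fin D) (Fin D) ℝ)
    (x : EuclideanSpace ℝ (Fin D)) :
    Matrix.toEuclideanLin ((1 - qrFactor A S * (qrFactor A S)ᵀ) * B) x =
      Matrix.toEuclideanLin B x -
        (span ℝ (range fun l => Matrix.toEuclideanLin A (S l))).starProjection
          (Matrix.toEuclideanLin B x) := by
  rw [← toEuclideanLin_qrFactor_mul_transpose, sub_mul, map_sub]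
  simp [Matrix.toLpLin_apply]

theorem qrFactor_mul_transpose_idem :
    (qrFactor A S * (qrFactor A S)ᵀ) * (qrFactor A S * (qrFactor A S)ᵀ) =
      qrFactor A S * (qrFactor A S)ᵀ := by
  apply Matrix.toEuclideanLin.injective
  ext x : 1
  have h : ∀ B C : Matrix (Fin D) (Fin D) ℝ, Matrix.toEuclideanLin (B * C) x =
      Matrix.toEuclideanLin B (Matrix.toEuclideanLin C x) := by
    intro B C
    simp [Matrix.toLpLin_apply]
  rw [h, toEuclideanLin_qrFactor_mul_transpose, toEuclideanLin_qrFactor_mul_transpose,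
    starProjection_eq_self_iff]
  exact starProjection_apply_mem _ _

theorem qrFactor_mul_transpose_symm :
    (qrFactor A S * (qrFactor A S)ᵀ)ᵀ = qrFactor A S * (qrFactor A S)ᵀ := by simp

/-- By cyclicity and idempotence the two traces are `Tr(PB)` and `Tr((I-P)B)`. This is what makes
the estimator unbiased for every `Q`, even a stale one. -/
theorem trace_add_trace (B : Matrix (Fin D) (Fin D) ℝ) :
    ((qrFactor A S)ᵀ * B * qrFactor A S).trace +
      ((1 - qrFactor A S * (qrFactor A S)ᵀ) * B * (1 - qrFactor A S * (qrFactor A S)ᵀ)).trace =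
      B.trace := by
  have h := qrFactor_mul_transpose_idem A S
  set P := qrFactor A S * (qrFactor A S)ᵀ with hP
  have h1 : ((qrFactor A S)ᵀ * B * qrFactor A S).trace = (P * B).trace := by
    rw [Matrix.trace_mul_cycle]
  have h2 : (1 - P) * (1 - P) = 1 - P := by
    rw [sub_mul, mul_sub, mul_sub, h]
    simp
  rw [h1, Matrix.trace_mul_cycle (1 - P) B (1 - P), h2, ← Matrix.trace_add, ← add_mul]
  simp

theorem norm_one_sub_mul_le (B : Matrix (Fin D) (Fin D) ℝ) :
    ‖(1 - qrFactor A S * (qrFactor A S)ᵀ) * B‖ ≤ ‖B‖ := by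
  refine le_of_sq_le_sq ?_ (norm_nonneg _)
  let b := EuclideanSpace.basisFun (Fin D) ℝ
  rw [norm_sq_eq_sum_basis _ b, norm_sq_eq_sum_basis _ b]
  refine Finset.sum_le_sum fun i _ => ?_
  rw [toEuclideanLin_one_sub_mul]
  gcongr
  simpa using norm_sub_starProjection_le
    (span ℝ (range fun l => Matrix.toEuclideanLin A (S l)))
    (Matrix.toEuclideanLin B (b i)) (zero_mem _)

theorem norm_mul_one_sub_le (B : Matrix (Fin D) (Fin D) ℝ) :
    ‖B * (1 - qrFactor A S * (qrFactor A S)ᵀ)‖ ≤ ‖B‖ := by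
  rw [← Matrix.frobenius_norm_transpose, Matrix.transpose_mul, Matrix.transpose_sub,
    qrFactor_mul_transpose_symm, Matrix.transpose_one]
  exact (norm_one_sub_mul_le A S _).trans_eq (Matrix.frobenius_norm_transpose _)

end qr

/-! ### Measurability of the estimator. -/

section measurability

variable {α : Type*} [MeasurableSpace α] {D n : ℕ}

/-- Gram–Schmidt is discontinuous where the rank drops, but its recursion uses only measurable
operations, division by zero included. -/
theorem measurable_gramSchmidtNormed {E : Type*} [NormedAddCommGroup E] [InnerProductSpace ℝ E]
    [FiniteDimensional ℝ E] [MeasurableSpace E] [BorelSpace E] {v : α → Fin n → E}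
    (hv : ∀ l, Measurable fun a => v a l) (l : Fin n) :
    Measurable fun a => gramSchmidtNormed ℝ (v a) l := by
  have h : ∀ l, Measurable fun a => gramSchmidt ℝ (v a) l := by
    intro l
    induction l using WellFoundedLT.induction with
    | ind l ih =>
      have : (fun a => gramSchmidt ℝ (v a) l) = fun a => v a l - ∑ i ∈ Finset.Iio l,
          (inner ℝ (gramSchmidt ℝ (v a) i) (v a l) / ‖gramSchmidt ℝ (v a) i‖ ^ 2) •
            gramSchmidt ℝ (v a) i := by
        funext a
        exact eq_sub_of_add_eq (gramSchmidt_def'' ℝ (v a) l).symm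
      rw [this]
      refine (hv l).sub (Finset.measurable_sum _ fun i hi => ?_)
      have := ih i (Finset.mem_Iio.1 hi)
      exact ((this.inner (hv l)).div (this.norm.pow_const 2)).smul this
  unfold gramSchmidtNormed
  exact ((h l).norm.inv).smul (h l)

theorem measurable_approxHutchPP {A B : α → Matrix (Fin D) (Fin D) ℝ}
    {S G : α → Fin n → EuclideanSpace ℝ (Fin D)}
    (hA : ∀ i j, Measurable fun a => A a i j) (hB : ∀ i j, Measurable fun a => B a i j)
    (hS : ∀ l, Measurable fun a => S a l) (hG : ∀ l, Measurable fun a => G a l) :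
    Measurable fun a => approxHutchPP (A a) (B a) (S a) (G a) := by
  have hAS : ∀ l, Measurable fun a => (WithLp.toLp 2 (A a *ᵥ (S a l).ofLp) :
      EuclideanSpace ℝ (Fin D)) := by
    intro l
    refine (MeasurableEquiv.toLp 2 (Fin D → ℝ)).measurable.comp ?_
    refine measurable_pi_iff.2 fun i => ?_
    simp only [Matrix.mulVec, dotProduct]
    exact Finset.measurable_sum _ fun j _ => (hA i j).mul
      ((by fun_prop : Measurable fun x : EuclideanSpace ℝ (Fin D) => x.ofLp j).comp (hS l))
  have hQ : ∀ i l, Measurable fun a => qrFactor (A a) (S a) i l := fun i l =>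
    (by fun_prop : Measurable fun x : EuclideanSpace ℝ (Fin D) => x.ofLp i).comp
      (measurable_gramSchmidtNormed hAS l)
  have hGi : ∀ l i, Measurable fun a => (G a l).ofLp i := fun l i =>
    (by fun_prop : Measurable fun x : EuclideanSpace ℝ (Fin D) => x.ofLp i).comp (hG l)
  simp only [approxHutchPP, hutchinson, Matrix.trace, Matrix.diag, Matrix.mul_apply,
    Matrix.transpose_apply, Matrix.sub_apply, dotProduct, Matrix.mulVec]
  fun_prop

end measurability

/-! ### Moments of the square of a Gaussian variable. -/

theorem memLp_sq_gaussianReal : MemLp (fun x : ℝ => x ^ 2) 2 (gaussianReal 0 1) := by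
  rw [memLp_two_iff_integrable_sq (by fun_prop)]
  have h := (memLp_id_gaussianReal' (μ := 0) (v := 1) 4 (by simp)).integrable_norm_pow (by simp)
  refine h.congr (Filter.Eventually.of_forall fun x => ?_)
  simp only [id, Real.norm_eq_abs]
  rw [← pow_mul, ← abs_pow, abs_of_nonneg (by positivity)]

theorem integral_sq_gaussianReal : ∫ x, x ^ 2 ∂gaussianReal 0 1 = 1 := by
  have h := variance_fun_id_gaussianReal (μ := 0) (v := 1)
  rw [variance_of_integral_eq_zero (by fun_prop) (by simp)] at h
  simpa using h

theorem integral_pow_four_gaussianReal : ∫ x, x ^ 4 ∂gaussianReal 0 1 = 3 := by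
  have h := iteratedDeriv_mgf_zero (X := id) (μ := gaussianReal 0 1) (by simp) 4
  -- Differentiation sends `p·exp(t²/2)` to `(p' + tp)·exp(t²/2)`. Starting from `1`, four rounds
  -- give `3 + 6t² + t⁴`, whose value at `0` is the fourth moment.
  have h' : ∀ (p q : ℝ → ℝ), (∀ t, HasDerivAt p (q t) t) →
      deriv (fun t => p t * Real.exp (t ^ 2 / 2)) =
        fun t => (q t + t * p t) * Real.exp (t ^ 2 / 2) := by
    intro p q hp
    funext t
    have h1 : HasDerivAt (fun t : ℝ => t ^ 2 / 2) t t := by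
      have := (hasDerivAt_pow 2 t).div_const 2
      simpa using this
    rw [((hp t).fun_mul h1.exp).deriv]
    ring
  have h0 : mgf id (gaussianReal 0 1) = fun t => 1 * Real.exp (t ^ 2 / 2) := by
    rw [mgf_id_gaussianReal]; simp
  rw [h0, iteratedDeriv_succ, iteratedDeriv_succ, iteratedDeriv_succ, iteratedDeriv_one,
    h' _ (fun _ => 0) (fun t => hasDerivAt_const t 1),
    h' _ (fun _ => 1) (fun t => by simpa using hasDerivAt_id' t),
    h' _ (fun t => 2 * t) (fun t => ?_), h' _ (fun t => 3 + 3 * t ^ 2) (fun t => ?_)] at h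
  · simpa using h.symm
  · have := ((hasDerivAt_id' t).const_mul 3).add (hasDerivAt_pow 3 t)
    refine (this.congr_deriv ?_).congr_of_eventuallyEq (Filter.Eventually.of_forall fun x => ?_)
    · norm_num
    · simp only [Pi.add_apply]; ring
  · have := (hasDerivAt_pow 2 t).const_add (1 : ℝ)
    refine (this.congr_deriv ?_).congr_of_eventuallyEq (Filter.Eventually.of_forall fun x => ?_)
    · norm_num
    · simp only []; ring

theorem variance_sq_gaussianReal : Var[fun x : ℝ => x ^ 2; gaussianReal 0 1] = 2 := by
  rw [variance_eq_sub memLp_sq_gaussianReal, integral_sq_gaussianReal]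
  have : (fun x : ℝ => x ^ 2) ^ 2 = fun x : ℝ => x ^ 4 := by
    funext x; simp only [Pi.pow_apply]; ring
  rw [this, integral_pow_four_gaussianReal]
  norm_num

/-! ### Gaussian quadratic forms and the Hutchinson estimator. -/

section quadratic

variable {D : ℕ} {R : Matrix (Fin D) (Fin D) ℝ}

theorem dotProduct_mulVec_eq_sum (hR : R.IsHermitian) (x : Fin D → ℝ) :
    (∑ i, x i • hR.eigenvectorBasis i).ofLp ⬝ᵥ
      (R *ᵥ (∑ i, x i • hR.eigenvectorBasis i).ofLp) = ∑ i, hR.eigenvalues i * x i ^ 2 := by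
  set b := hR.eigenvectorBasis
  have h1 : R *ᵥ (∑ i, x i • b i).ofLp = (∑ i, (hR.eigenvalues i * x i) • b i).ofLp := by
    simp only [WithLp.ofLp_sum, WithLp.ofLp_smul, Matrix.mulVec_sum, Matrix.mulVec_smul]
    refine Finset.sum_congr rfl fun i _ => ?_
    rw [hR.mulVec_eigenvectorBasis, smul_smul, mul_comm]
  have h2 : ∀ u v : EuclideanSpace ℝ (Fin D), u.ofLp ⬝ᵥ v.ofLp = inner ℝ u v := by
    intro u v
    simp [PiLp.inner_apply, dotProduct, mul_comm]
  rw [h1, h2, b.orthonormal.inner_sum]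
  refine Finset.sum_congr rfl fun i _ => ?_
  simp only [conj_trivial]; ring

theorem sum_eigenvalues_sq (hR : R.IsHermitian) : ∑ i, hR.eigenvalues i ^ 2 = ‖R‖ ^ 2 := by
  rw [norm_sq_eq_sum_basis _ hR.eigenvectorBasis]
  refine Finset.sum_congr rfl fun i _ => ?_
  rw [Matrix.toLpLin_apply, hR.mulVec_eigenvectorBasis, WithLp.toLp_smul, norm_smul]
  simp

theorem map_stdGaussian_eigenvectorBasis (hR : R.IsHermitian) :
    stdGaussian (EuclideanSpace ℝ (Fin D)) =
      (Measure.pi fun _ : Fin D => gaussianReal 0 1).map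
        fun x => ∑ i, x i • hR.eigenvectorBasis i :=
  stdGaussian_eq_map_pi_orthonormalBasis _

theorem measurable_quadratic (R : Matrix (Fin D) (Fin D) ℝ) :
    Measurable fun g : EuclideanSpace ℝ (Fin D) => g.ofLp ⬝ᵥ (R *ᵥ g.ofLp) := by
  simp only [dotProduct, Matrix.mulVec]
  fun_prop

theorem memLp_eigen_sum (hR : R.IsHermitian) (i : Fin D) :
    MemLp (fun x : ℝ => hR.eigenvalues i * x ^ 2) 2 (gaussianReal 0 1) :=
  memLp_sq_gaussianReal.const_mul _

theorem memLp_eval_eigen (hR : R.IsHermitian) (i : Fin D) :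
    MemLp (fun x : Fin D → ℝ => hR.eigenvalues i * x i ^ 2) 2
      (Measure.pi fun _ => gaussianReal 0 1) :=
  (memLp_eigen_sum hR i).comp_measurePreserving
    (measurePreserving_eval (fun _ : Fin D => gaussianReal 0 1) i)

theorem memLp_quadratic (hR : R.IsHermitian) :
    MemLp (fun g => g.ofLp ⬝ᵥ (R *ᵥ g.ofLp)) 2 (stdGaussian (EuclideanSpace ℝ (Fin D))) := by
  rw [map_stdGaussian_eigenvectorBasis hR, memLp_map_measure_iff
    (measurable_quadratic R).aestronglyMeasurable (Measurable.aemeasurable (by fun_prop))]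
  simp only [Function.comp_def, dotProduct_mulVec_eq_sum hR]
  exact memLp_finsetSum _ fun i _ => memLp_eval_eigen hR i

theorem integral_quadratic (hR : R.IsHermitian) :
    ∫ g, g.ofLp ⬝ᵥ (R *ᵥ g.ofLp) ∂stdGaussian (EuclideanSpace ℝ (Fin D)) = R.trace := by
  rw [map_stdGaussian_eigenvectorBasis hR, integral_map (Measurable.aemeasurable (by fun_prop))
    (measurable_quadratic R).aestronglyMeasurable]
  simp only [dotProduct_mulVec_eq_sum hR]
  rw [integral_finsetSum _ fun i _ => (memLp_eval_eigen hR i).integrable (by norm_num),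
    hR.trace_eq_sum_eigenvalues]
  refine Finset.sum_congr rfl fun i _ => ?_
  rw [integral_comp_eval (μ := fun _ : Fin D => gaussianReal 0 1)
    (f := fun x : ℝ => hR.eigenvalues i * x ^ 2) (by fun_prop), integral_const_mul,
    integral_sq_gaussianReal]
  simp

/-- By rotation invariance the form is `∑ λᵢxᵢ²` with independent standard Gaussian `xᵢ`, each
square having variance `2`. -/
theorem variance_quadratic (hR : R.IsHermitian) :
    Var[fun g => g.ofLp ⬝ᵥ (R *ᵥ g.ofLp); stdGaussian (EuclideanSpace ℝ (Fin D))] =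
      2 * ‖R‖ ^ 2 := by
  rw [map_stdGaussian_eigenvectorBasis hR, variance_map
    (measurable_quadratic R).aemeasurable (Measurable.aemeasurable (by fun_prop))]
  have h : (fun g : EuclideanSpace ℝ (Fin D) => g.ofLp ⬝ᵥ (R *ᵥ g.ofLp)) ∘
      (fun x : Fin D → ℝ => ∑ i, x i • hR.eigenvectorBasis i) =
      ∑ i, fun x : Fin D → ℝ => hR.eigenvalues i * x i ^ 2 := by
    funext x
    simp only [Function.comp_def, dotProduct_mulVec_eq_sum hR, Finset.sum_apply]
  rw [h, variance_sum_pi (μ := fun _ : Fin D => gaussianReal 0 1)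
    (X := fun i x => hR.eigenvalues i * x ^ 2) (memLp_eigen_sum hR), ← sum_eigenvalues_sq hR,
    Finset.mul_sum]
  refine Finset.sum_congr rfl fun i _ => ?_
  rw [variance_const_mul, variance_sq_gaussianReal, mul_comm]

theorem memLp_eval_quadratic {n : ℕ} (hR : R.IsHermitian) (i : Fin n) :
    MemLp (fun G : Fin n → EuclideanSpace ℝ (Fin D) => (G i).ofLp ⬝ᵥ (R *ᵥ (G i).ofLp)) 2
      (Measure.pi fun _ => stdGaussian (EuclideanSpace ℝ (Fin D))) :=
  (memLp_quadratic hR).comp_measurePreserving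
    (measurePreserving_eval (fun _ : Fin n => stdGaussian (EuclideanSpace ℝ (Fin D))) i)

theorem memLp_hutchinson {n : ℕ} (hR : R.IsHermitian) :
    MemLp (fun G : Fin n → EuclideanSpace ℝ (Fin D) => hutchinson G R) 2
      (Measure.pi fun _ => stdGaussian (EuclideanSpace ℝ (Fin D))) := by
  unfold hutchinson
  exact (memLp_finsetSum _ fun i _ => memLp_eval_quadratic hR i).const_mul _

theorem integral_hutchinson {n : ℕ} (hn : 0 < n) (hR : R.IsHermitian) :
    ∫ G : Fin n → EuclideanSpace ℝ (Fin D), hutchinson G R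
      ∂(Measure.pi fun _ => stdGaussian (EuclideanSpace ℝ (Fin D))) = R.trace := by
  unfold hutchinson
  rw [integral_const_mul, integral_finsetSum]
  · have : ∀ i : Fin n, ∫ G : Fin n → EuclideanSpace ℝ (Fin D), (G i).ofLp ⬝ᵥ (R *ᵥ (G i).ofLp)
        ∂(Measure.pi fun _ => stdGaussian (EuclideanSpace ℝ (Fin D))) = R.trace := by
      intro i
      rw [integral_comp_eval (μ := fun _ : Fin n => stdGaussian (EuclideanSpace ℝ (Fin D)))
        (f := fun g : EuclideanSpace ℝ (Fin D) => g.ofLp ⬝ᵥ (R *ᵥ g.ofLp))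
        (measurable_quadratic R).aestronglyMeasurable, integral_quadratic hR]
    simp only [this, Finset.sum_const, Finset.card_univ, Fintype.card_fin, nsmul_eq_mul]
    field_simp
  · intro i _
    exact (memLp_eval_quadratic hR i).integrable (by norm_num)

theorem variance_hutchinson {n : ℕ} (hn : 0 < n) (hR : R.IsHermitian) :
    Var[fun G : Fin n → EuclideanSpace ℝ (Fin D) => hutchinson G R;
      Measure.pi fun _ => stdGaussian (EuclideanSpace ℝ (Fin D))] = 2 / n * ‖R‖ ^ 2 := by
  unfold hutchinson
  rw [variance_const_mul]
  have h : (fun G : Fin n → EuclideanSpace ℝ (Fin D) => ∑ i, (G i).ofLp ⬝ᵥ (R *ᵥ (G i).ofLp)) =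
      ∑ i, fun G : Fin n → EuclideanSpace ℝ (Fin D) => (G i).ofLp ⬝ᵥ (R *ᵥ (G i).ofLp) := by
    funext G; simp
  rw [h, variance_sum_pi (μ := fun _ : Fin n => stdGaussian (EuclideanSpace ℝ (Fin D)))
    (X := fun _ g => g.ofLp ⬝ᵥ (R *ᵥ g.ofLp)) fun _ => memLp_quadratic hR]
  simp only [variance_quadratic hR, Finset.sum_const, Finset.card_univ, Fintype.card_fin,
    nsmul_eq_mul]
  field_simp

theorem lintegral_hutchinson_sub_trace_sq {n : ℕ} (hn : 0 < n) (hR : R.IsHermitian) :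
    ∫⁻ G : Fin n → EuclideanSpace ℝ (Fin D), ENNReal.ofReal ((hutchinson G R - R.trace) ^ 2)
      ∂(Measure.pi fun _ => stdGaussian (EuclideanSpace ℝ (Fin D))) =
      ENNReal.ofReal (2 / n * ‖R‖ ^ 2) := by
  rw [← variance_hutchinson hn hR, (memLp_hutchinson hR).ofReal_variance_eq,
    evariance_eq_lintegral_ofReal, integral_hutchinson hn hR]

end quadratic

/-! ### Inverse moments of Gaussian projections. -/

/-- Turns `E[1/‖·‖²]` into an integral of Laplace transforms. At `r = 0` both sides are infinite, so
it applies before the norm is known to be almost surely nonzero. -/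
theorem lintegral_exp_neg_mul_Ioi {r : ℝ} (hr : 0 ≤ r) :
    ∫⁻ s in Ioi (0 : ℝ), ENNReal.ofReal (Real.exp (-s * r)) = (ENNReal.ofReal r)⁻¹ := by
  rcases hr.eq_or_lt with rfl | hr
  · simp
  · have h1 := integral_exp_mul_Ioi (neg_neg_of_pos hr) 0
    rw [← ENNReal.ofReal_inv_of_pos hr]
    have h2 : ∀ s : ℝ, -s * r = -r * s := fun s => by ring
    simp only [h2]
    rw [← ofReal_integral_eq_lintegral_ofReal (integrableOn_exp_mul_Ioi (neg_neg_of_pos hr) 0)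
      (ae_of_all _ fun s => (Real.exp_pos _).le), h1]
    simp [div_neg, neg_div]

theorem integral_exp_neg_mul_sq_gaussianReal {s : ℝ} (hs : 0 ≤ s) :
    ∫ x, Real.exp (-s * x ^ 2) ∂gaussianReal 0 1 = (√(1 + 2 * s))⁻¹ := by
  rw [integral_gaussianReal_eq_integral_smul one_ne_zero]
  have h : ∀ x : ℝ, gaussianPDFReal 0 1 x • Real.exp (-s * x ^ 2) =
      (√(2 * Real.pi))⁻¹ * Real.exp (-(s + 1 / 2) * x ^ 2) := by
    intro x
    rw [gaussianPDFReal_def, smul_eq_mul, mul_assoc, ← Real.exp_add]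
    simp only [NNReal.coe_one, mul_one, sub_zero]
    congr 2
    ring
  simp only [h]
  rw [integral_const_mul, integral_gaussian, ← Real.sqrt_inv, ← Real.sqrt_mul (by positivity),
    ← Real.sqrt_inv]
  congr 1
  field_simp
  ring

/-- The antiderivative is `-(1+2s)^(-(d-2)/2)/(d-2)`; `d ≥ 3` makes it vanish at infinity. -/
theorem lintegral_inv_sqrt_pow_Ioi {d : ℕ} (hd : 3 ≤ d) :
    ∫⁻ s in Ioi (0 : ℝ), ENNReal.ofReal ((√(1 + 2 * s))⁻¹ ^ d) =
      ENNReal.ofReal (1 / ((d : ℝ) - 2)) := by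
  have hd' : (0 : ℝ) < (d : ℝ) - 2 := by
    have : (3 : ℝ) ≤ d := by exact_mod_cast hd
    linarith
  have h1 : ∀ s ∈ Ici (0 : ℝ), HasDerivAt
      (fun s : ℝ => -(1 / ((d : ℝ) - 2)) * (1 + 2 * s) ^ (-(((d : ℝ) - 2) / 2)))
      ((√(1 + 2 * s))⁻¹ ^ d) s := by
    intro s hs
    have hs' : (0 : ℝ) < 1 + 2 * s := by have : (0 : ℝ) ≤ s := hs; linarith
    have h2 : HasDerivAt (fun s : ℝ => 1 + 2 * s) 2 s := by
      simpa using ((hasDerivAt_id' s).const_mul 2).const_add 1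
    have h3 := (h2.rpow_const (p := -(((d : ℝ) - 2) / 2)) (Or.inl hs'.ne')).const_mul
      (-(1 / ((d : ℝ) - 2)))
    refine h3.congr_deriv ?_
    have h4 : (√(1 + 2 * s))⁻¹ ^ d = (1 + 2 * s) ^ (-(((d : ℝ) - 2) / 2) - 1) := by
      rw [Real.sqrt_eq_rpow, ← Real.rpow_neg hs'.le, ← Real.rpow_natCast, ← Real.rpow_mul hs'.le]
      congr 1; ring
    rw [h4]
    field_simp
  have h2 : ∀ s ∈ Ioi (0 : ℝ), 0 ≤ (√(1 + 2 * s))⁻¹ ^ d := fun s _ => by positivity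
  have h3 : Filter.Tendsto
      (fun s : ℝ => -(1 / ((d : ℝ) - 2)) * (1 + 2 * s) ^ (-(((d : ℝ) - 2) / 2)))
      Filter.atTop (nhds 0) := by
    have h := (tendsto_rpow_neg_atTop (half_pos hd')).comp
      (Filter.tendsto_atTop_add_const_left _ 1
        (Filter.tendsto_id.const_mul_atTop (zero_lt_two' ℝ)))
    simpa using h.const_mul (-(1 / ((d : ℝ) - 2)))
  rw [← ofReal_integral_eq_lintegral_ofReal (integrableOn_Ioi_deriv_of_nonneg' h1 h2 h3)
    ((ae_restrict_mem measurableSet_Ioi).mono h2),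
    integral_Ioi_of_hasDerivAt_of_nonneg' h1 h2 h3]
  simp

section projection

variable {F : Type*} [NormedAddCommGroup F] [InnerProductSpace ℝ F] [FiniteDimensional ℝ F]

theorem exists_orthonormalBasis_mem (U : Submodule ℝ F) :
    ∃ b : OrthonormalBasis (Fin (Module.finrank ℝ F)) ℝ F,
      ∀ i : Fin (Module.finrank ℝ F), (i : ℕ) < Module.finrank ℝ U → b i ∈ U := by
  let u := stdOrthonormalBasis ℝ U
  let s : Set (Fin (Module.finrank ℝ F)) := {i | (i : ℕ) < Module.finrank ℝ U}
  let v : Fin (Module.finrank ℝ F) → F := fun i =>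
    if h : (i : ℕ) < Module.finrank ℝ U then (u ⟨i, h⟩ : F) else 0
  have hu : Orthonormal ℝ fun i => (u i : F) := u.orthonormal.comp_linearIsometry U.subtypeₗᵢ
  have hv : Orthonormal ℝ (s.domRestrict v) := by
    have h := hu.comp (fun i : s => (⟨i.1, i.2⟩ : Fin (Module.finrank ℝ U)))
      (fun i j hij => by
        apply Subtype.ext; apply Fin.ext; simpa using hij)
    convert h using 1
    funext i
    exact dif_pos i.2
  obtain ⟨b, hb⟩ := hv.exists_orthonormalBasis_extension_of_card_eq (by simp)
  refine ⟨b, fun i hi => ?_⟩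
  rw [hb i hi]
  simp only [v, dif_pos hi]
  exact (u ⟨i, hi⟩).2

theorem sum_sq_le_norm_starProjection_sq (U : Submodule ℝ F) {ι : Type*} [Fintype ι]
    (b : OrthonormalBasis ι ℝ F) (t : Finset ι) (ht : ∀ i ∈ t, b i ∈ U) (x : ι → ℝ) :
    ∑ i ∈ t, x i ^ 2 ≤ ‖U.starProjection (∑ i, x i • b i)‖ ^ 2 := by
  refine le_trans (le_of_eq ?_)
    (b.orthonormal.sum_inner_products_le (x := U.starProjection (∑ i, x i • b i)) (s := t))
  refine Finset.sum_congr rfl fun i hi => ?_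
  rw [← Submodule.inner_starProjection_left_eq_right,
    Submodule.starProjection_eq_self_iff.2 (ht i hi), b.orthonormal.inner_right_fintype]
  simp

variable [MeasurableSpace F] [BorelSpace F]

/-- In an orthonormal basis whose first vectors lie in `U`, Bessel's inequality bounds the
exponential by a product over `dim U` independent coordinates. -/
theorem lintegral_exp_neg_norm_starProjection_sq_le (U : Submodule ℝ F) {s : ℝ} (hs : 0 ≤ s) :
    ∫⁻ g, ENNReal.ofReal (Real.exp (-s * ‖U.starProjection g‖ ^ 2)) ∂stdGaussian F ≤
      ENNReal.ofReal ((√(1 + 2 * s))⁻¹ ^ Module.finrank ℝ U) := by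
  classical
  obtain ⟨b, hb⟩ := exists_orthonormalBasis_mem U
  set t : Finset (Fin (Module.finrank ℝ F)) :=
    Finset.univ.filter fun i => (i : ℕ) < Module.finrank ℝ U with ht
  have htc : t.card = Module.finrank ℝ U := by
    have := Submodule.finrank_le U
    rw [ht, Fin.card_filter_val_lt, min_eq_right this]
  rw [stdGaussian_eq_map_pi_orthonormalBasis b, lintegral_map (by fun_prop)
    (by fun_prop)]
  let φ : Fin (Module.finrank ℝ F) → ℝ → ℝ := fun i x => if i ∈ t then Real.exp (-s * x ^ 2) else 1
  have hφ : ∀ i x, 0 ≤ φ i x ∧ φ i x ≤ 1 := by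
    intro i x
    by_cases h : i ∈ t
    · simp only [φ, h, if_true]
      exact ⟨(Real.exp_pos _).le, Real.exp_le_one_iff.2 (by nlinarith [sq_nonneg x])⟩
    · simp [φ, h]
  have hφm : ∀ i, Measurable (φ i) := by
    intro i
    by_cases h : i ∈ t
    · simp only [φ, h, if_true]; fun_prop
    · simp only [φ, h, if_false]; fun_prop
  have hpm : Measurable fun x : Fin (Module.finrank ℝ F) → ℝ => ∏ i, φ i (x i) :=
    Finset.measurable_prod _ fun i _ => (hφm i).comp (measurable_pi_apply i)
  calc _ ≤ ∫⁻ x : Fin (Module.finrank ℝ F) → ℝ, ENNReal.ofReal (∏ i, φ i (x i))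
        ∂Measure.pi fun _ => gaussianReal 0 1 := by
        refine lintegral_mono fun x => ENNReal.ofReal_le_ofReal ?_
        simp only [φ]
        rw [Finset.prod_ite_mem, Finset.univ_inter, ← Real.exp_sum, Real.exp_le_exp,
          ← Finset.mul_sum]
        have := sum_sq_le_norm_starProjection_sq U b t
          (fun i hi => hb i (by simpa [ht] using hi)) x
        nlinarith
    _ = ENNReal.ofReal (∏ i, ∫ x, φ i x ∂gaussianReal 0 1) := by
        rw [← integral_fintype_prod_eq_prod (μ := fun _ => gaussianReal 0 1),
          ofReal_integral_eq_lintegral_ofReal]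
        · refine Integrable.of_bound hpm.aestronglyMeasurable 1 (ae_of_all _ fun x => ?_)
          rw [Real.norm_of_nonneg (Finset.prod_nonneg fun i _ => (hφ i _).1)]
          exact Finset.prod_le_one (fun i _ => (hφ i _).1) fun i _ => (hφ i _).2
        · exact ae_of_all _ fun x => Finset.prod_nonneg fun i _ => (hφ i _).1
    _ = _ := by
        congr 1
        have : ∀ i, ∫ x, φ i x ∂gaussianReal 0 1 = if i ∈ t then (√(1 + 2 * s))⁻¹ else 1 := by
          intro i
          by_cases h : i ∈ t
          · simp only [φ, h, if_true]
            exact integral_exp_neg_mul_sq_gaussianReal hs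
          · simp [φ, h]
        simp only [this]
        rw [Finset.prod_ite_mem, Finset.univ_inter, Finset.prod_const, htc]

/-- The bound `E[1/χ²] ≤ 1/(d-2)`. A lower bound `d` on the dimension suffices, because
`(1+2s)^(-1/2) ≤ 1`. -/
theorem lintegral_inv_norm_starProjection_sq_le (U : Submodule ℝ F) {d : ℕ} (hd : 3 ≤ d)
    (hU : d ≤ Module.finrank ℝ U) :
    ∫⁻ g, (ENNReal.ofReal (‖U.starProjection g‖ ^ 2))⁻¹ ∂stdGaussian F ≤
      ENNReal.ofReal (1 / ((d : ℝ) - 2)) := by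
  have hm : Measurable fun p : F × ℝ =>
      ENNReal.ofReal (Real.exp (-p.2 * ‖U.starProjection p.1‖ ^ 2)) := by fun_prop
  calc _ = ∫⁻ g, (∫⁻ s in Ioi (0 : ℝ),
          ENNReal.ofReal (Real.exp (-s * ‖U.starProjection g‖ ^ 2))) ∂stdGaussian F := by
        refine lintegral_congr fun g => ?_
        rw [lintegral_exp_neg_mul_Ioi (by positivity)]
    _ = ∫⁻ s in Ioi (0 : ℝ), ∫⁻ g, ENNReal.ofReal (Real.exp (-s * ‖U.starProjection g‖ ^ 2))
        ∂stdGaussian F := lintegral_lintegral_swap hm.aemeasurable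
    _ ≤ ∫⁻ s in Ioi (0 : ℝ), ENNReal.ofReal ((√(1 + 2 * s))⁻¹ ^ d) := by
        refine setLIntegral_mono (by fun_prop) fun s hs => ?_
        refine (lintegral_exp_neg_norm_starProjection_sq_le U (le_of_lt hs)).trans ?_
        refine ENNReal.ofReal_le_ofReal (pow_le_pow_of_le_one (by positivity) ?_ hU)
        refine inv_le_one_of_one_le₀ (Real.one_le_sqrt.2 ?_)
        have : (0 : ℝ) < s := hs
        linarith
    _ = _ := lintegral_inv_sqrt_pow_Ioi hd

theorem lintegral_inner_sq_stdGaussian (w : F) :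
    ∫⁻ g, ENNReal.ofReal (inner ℝ w g ^ 2) ∂stdGaussian F = ENNReal.ofReal (‖w‖ ^ 2) := by
  have h := variance_dual_stdGaussian (innerSL ℝ w : StrongDual ℝ F)
  have hm : MemLp (innerSL ℝ w : StrongDual ℝ F) 2 (stdGaussian F) :=
    IsGaussian.memLp_dual _ _ _ (by simp)
  have h2 := hm.ofReal_variance_eq
  rw [h, innerSL_apply_norm, evariance_eq_lintegral_ofReal] at h2
  rw [h2, integral_strongDual_stdGaussian]
  simp

end projection

/-! ### Columns and rows of a Gaussian matrix. -/

theorem map_pi_stdGaussian {ι F : Type*} [Fintype ι] [NormedAddCommGroup F]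
    [InnerProductSpace ℝ F] [FiniteDimensional ℝ F] [MeasurableSpace F] [BorelSpace F] :
    (Measure.pi fun _ : ι => stdGaussian F).map (WithLp.toLp 2) =
      stdGaussian (PiLp 2 fun _ : ι => F) := by
  apply Measure.ext_of_charFun
  ext t
  rw [charFun_pi, charFun_stdGaussian]
  simp_rw [charFun_stdGaussian, ← Complex.exp_sum, ← Complex.ofReal_pow]
  rw [PiLp.norm_sq_eq_of_L2]
  push_cast
  rw [← Finset.sum_div, Finset.sum_neg_distrib]

section rows

variable {E : Type*} [NormedAddCommGroup E] [InnerProductSpace ℝ E] [FiniteDimensional ℝ E]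
  {ι κ : Type*} [Fintype ι]

/-- The coordinate rows `(⟪vⱼ, S₁⟫, …, ⟪vⱼ, Sₙ⟫)` of a family of vectors. -/
noncomputable def coordRows (v : OrthonormalBasis ι ℝ E) (S : κ → E) (j : ι) : EuclideanSpace ℝ κ :=
  WithLp.toLp 2 fun a => inner ℝ (v j) (S a)

/-- The isometry taking a family of vectors to its coordinate rows. -/
noncomputable def coordRowsIsometry [Fintype κ] (v : OrthonormalBasis ι ℝ E) :
    (PiLp 2 fun _ : κ => E) →ₗᵢ[ℝ] PiLp 2 fun _ : ι => EuclideanSpace ℝ κ where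
  toFun S := WithLp.toLp 2 (coordRows v S.ofLp)
  map_add' S S' := by
    ext j a
    simp [coordRows, inner_add_right]
  map_smul' c S := by
    ext j a
    simp [coordRows, inner_smul_right]
  norm_map' S := by
    refine (sq_eq_sq₀ (norm_nonneg _) (norm_nonneg _)).1 ?_
    simp only [LinearMap.coe_mk, AddHom.coe_mk, PiLp.norm_sq_eq_of_L2]
    simp only [coordRows, Real.norm_eq_abs, sq_abs]
    rw [Finset.sum_comm]
    exact Finset.sum_congr rfl fun a _ => v.sum_sq_inner_right _

variable [MeasurableSpace E] [BorelSpace E]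

theorem measurable_coordRows (v : OrthonormalBasis ι ℝ E) :
    Measurable (coordRows v : (κ → E) → ι → EuclideanSpace ℝ κ) := by
  unfold coordRows
  fun_prop

/-- Passing from columns to rows in an orthonormal basis is a linear isometry between spaces of
equal dimension, and the standard Gaussian law is invariant under it. Hence the rows are again
independent and standard. -/
theorem map_coordRows [Fintype κ] (v : OrthonormalBasis ι ℝ E) :
    (Measure.pi fun _ : κ => stdGaussian E).map (coordRows v) =
      Measure.pi fun _ : ι => stdGaussian (EuclideanSpace ℝ κ) := by
  have hfin : Module.finrank ℝ (PiLp 2 fun _ : κ => E) =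
      Module.finrank ℝ (PiLp 2 fun _ : ι => EuclideanSpace ℝ κ) := by
    rw [(WithLp.linearEquiv 2 ℝ (κ → E)).finrank_eq,
      (WithLp.linearEquiv 2 ℝ (ι → EuclideanSpace ℝ κ)).finrank_eq, Module.finrank_pi_fintype,
      Module.finrank_pi_fintype]
    simp [Module.finrank_eq_card_basis v.toBasis, mul_comm]
  let e := (coordRowsIsometry (κ := κ) v).toLinearIsometryEquiv hfin
  have h := stdGaussian_map e
  rw [← map_pi_stdGaussian, ← map_pi_stdGaussian, Measure.map_map (by fun_prop) (by fun_prop)] at h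
  have h2 := congrArg (Measure.map WithLp.ofLp) h
  rw [Measure.map_map (by fun_prop) (by fun_prop), Measure.map_map (by fun_prop) (by fun_prop)] at h2
  have h3 : (WithLp.ofLp ∘ WithLp.toLp 2 : (ι → EuclideanSpace ℝ κ) → _) = id := rfl
  rw [h3, Measure.map_id] at h2
  exact h2

end rows

/-- Resampling one coordinate does not change the expectation. It plays the role of conditioning on
the other coordinates. -/
theorem lintegral_pi_update {ι : Type*} [Fintype ι] [DecidableEq ι] {X : ι → Type*}
    [∀ i, MeasurableSpace (X i)] (μ : ∀ i, Measure (X i)) [∀ i, IsProbabilityMeasure (μ i)]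
    (i : ι) {f : (∀ i, X i) → ENNReal} (hf : Measurable f) :
    ∫⁻ x, f x ∂Measure.pi μ = ∫⁻ x, ∫⁻ y, f (Function.update x i y) ∂μ i ∂Measure.pi μ := by
  rcases isEmpty_or_nonempty (∀ i, X i) with h | ⟨⟨x₀⟩⟩
  · simp
  have hg : Measurable fun x => ∫⁻ y, f (Function.update x i y) ∂μ i := by
    have := hf.lmarginal μ (s := {i})
    rwa [lmarginal_singleton] at this
  rw [lintegral_eq_lmarginal_univ x₀, lintegral_eq_lmarginal_univ x₀,
    lmarginal_erase' f hf (Finset.mem_univ i), lmarginal_erase' _ hg (Finset.mem_univ i)]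
  simp

/-! ### Residual of one Gaussian row against the others. -/

section residual

variable {F : Type*} [NormedAddCommGroup F] [InnerProductSpace ℝ F] {D : ℕ}

/-- The span of the rows with index in `t`, other than the `i`-th. -/
def otherSpan (t : Finset (Fin D)) (i : Fin D) (W : Fin D → F) : Submodule ℝ F :=
  Submodule.span ℝ (range fun l => if l ∈ t.erase i then W l else 0)

/-- The component of the `i`-th row orthogonal to the other rows with index in `t`. -/
noncomputable def residual [FiniteDimensional ℝ F] (t : Finset (Fin D)) (i : Fin D)
    (W : Fin D → F) : F :=
  W i - (otherSpan t i W).starProjection (W i)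

variable {t : Finset (Fin D)} {i : Fin D} (W : Fin D → F)

theorem finrank_otherSpan_le (hi : i ∈ t) :
    Module.finrank ℝ (otherSpan t i W) ≤ t.card - 1 := by
  classical
  rw [← Finset.card_erase_of_mem hi]
  have h : otherSpan t i W ≤ Submodule.span ℝ (((t.erase i).image W : Finset F) : Set F) := by
    refine Submodule.span_le.2 ?_
    rintro _ ⟨l, rfl⟩
    by_cases hl : l ∈ t.erase i
    · simp only [hl, if_true]
      exact Submodule.subset_span (Finset.mem_coe.2 (Finset.mem_image_of_mem W hl))
    · simp [hl]
  exact (Submodule.finrank_mono h).trans ((finrank_span_finset_le_card _).trans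
    Finset.card_image_le)

theorem otherSpan_update {j : Fin D} (hj : j ∉ t.erase i) (y : F) :
    otherSpan t i (Function.update W j y) = otherSpan t i W := by
  unfold otherSpan
  congr 2
  funext l
  by_cases hl : l ∈ t.erase i
  · simp only [hl, if_true]
    rw [Function.update_of_ne]
    rintro rfl
    exact hj hl
  · simp [hl]

variable [FiniteDimensional ℝ F]

theorem residual_update {j : Fin D} (hi : i ∈ t) (hj : j ∉ t) (y : F) :
    residual t i (Function.update W j y) = residual t i W := by
  have hij : i ≠ j := by
    rintro rfl
    exact hj hi
  simp only [residual, otherSpan_update W (fun h => hj (Finset.mem_of_mem_erase h)),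
    Function.update_of_ne hij]

theorem residual_update_self (y : F) :
    residual t i (Function.update W i y) = (otherSpan t i W)ᗮ.starProjection y := by
  simp only [residual, otherSpan_update W (Finset.notMem_erase i t), Function.update_self,
    Submodule.starProjection_orthogonal]
  simp

theorem inner_residual_of_mem {l : Fin D} (hl : l ∈ t) (hli : l ≠ i) :
    inner ℝ (W l) (residual t i W) = 0 := by
  have h : W l ∈ otherSpan t i W := by
    refine Submodule.subset_span ⟨l, ?_⟩
    simp [hl, hli]
  exact Submodule.inner_right_of_mem_orthogonal h
    (Submodule.sub_starProjection_mem_orthogonal _)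

theorem inner_residual_self : inner ℝ (W i) (residual t i W) = ‖residual t i W‖ ^ 2 := by
  have h := Submodule.inner_right_of_mem_orthogonal
    (Submodule.starProjection_apply_mem (otherSpan t i W) (W i))
    (Submodule.sub_starProjection_mem_orthogonal (K := otherSpan t i W) (W i))
  change inner ℝ _ (residual t i W) = 0 at h
  rw [← real_inner_self_eq_norm_sq]
  nth_rewrite 2 [residual]
  rw [inner_sub_left, h, sub_zero]

variable [MeasurableSpace F] [BorelSpace F]

/-- Rows outside the chosen set are replaced by zero, so the family keeps a fixed index type and the
Gram–Schmidt formula for the projection applies. -/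
theorem measurable_residual : Measurable (residual t i : (Fin D → F) → F) := by
  have h : (residual t i : (Fin D → F) → F) = fun W => W i - ∑ l, inner ℝ
      (InnerProductSpace.gramSchmidtNormed ℝ (fun l => if l ∈ t.erase i then W l else 0) l) (W i) •
      InnerProductSpace.gramSchmidtNormed ℝ (fun l => if l ∈ t.erase i then W l else 0) l := by
    funext W
    exact congrArg (W i - ·) (starProjection_span_eq_sum _ _)
  rw [h]
  have hg : ∀ l, Measurable fun W : Fin D → F =>
      InnerProductSpace.gramSchmidtNormed ℝ (fun l => if l ∈ t.erase i then W l else 0) l := by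
    refine measurable_gramSchmidtNormed fun l => ?_
    by_cases hl : l ∈ t.erase i
    · simp only [hl, if_true]; fun_prop
    · simp only [hl, if_false]; fun_prop
  refine (measurable_pi_apply i).sub (Finset.measurable_sum _ fun l _ => ?_)
  exact ((hg l).inner (measurable_pi_apply i)).smul (hg l)

/-- Once the other rows are fixed, the residual is a standard Gaussian projected onto the complement
of at most `t.card - 1` vectors. -/
theorem lintegral_inv_norm_residual_sq_le (hi : i ∈ t) (ht : t.card + 2 ≤ Module.finrank ℝ F) :
    ∫⁻ W, (ENNReal.ofReal (‖residual t i W‖ ^ 2))⁻¹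
        ∂(Measure.pi fun _ : Fin D => stdGaussian F) ≤
      ENNReal.ofReal (1 / ((Module.finrank ℝ F : ℝ) - t.card - 1)) := by
  have hm : Measurable fun W : Fin D → F => (ENNReal.ofReal (‖residual t i W‖ ^ 2))⁻¹ :=
    (measurable_residual.norm.pow_const 2).ennreal_ofReal.inv
  rw [lintegral_pi_update _ i hm]
  refine (lintegral_mono
    (g := fun _ => ENNReal.ofReal (1 / ((Module.finrank ℝ F : ℝ) - t.card - 1)))
    fun W => ?_).trans (by simp)
  simp only [residual_update_self]
  have h0 : 0 < t.card := Finset.card_pos.2 ⟨i, hi⟩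
  have h1 := finrank_otherSpan_le W hi
  have h2 := (otherSpan t i W).finrank_add_finrank_orthogonal
  -- The complement has dimension at least `n - (k-1)`, with `n` the ambient dimension and `k =
  -- t.card`. So `d - 2 = n - k - 1`, and the hypothesis on `k` is exactly `d ≥ 3`.
  refine (lintegral_inv_norm_starProjection_sq_le _
    (d := Module.finrank ℝ F + 1 - t.card) (by omega) (by omega)).trans (le_of_eq ?_)
  congr 2
  rw [Nat.cast_sub (by omega)]
  push_cast
  ring

/-- The inverse of `0` is infinite, so a finite expectation of the inverse rules out a zero residual
almost surely. -/
theorem ae_residual_ne_zero (hi : i ∈ t) (ht : t.card + 2 ≤ Module.finrank ℝ F) :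
    ∀ᵐ W ∂(Measure.pi fun _ : Fin D => stdGaussian F), residual t i W ≠ 0 := by
  have hm : Measurable fun W : Fin D → F => (ENNReal.ofReal (‖residual t i W‖ ^ 2))⁻¹ :=
    (measurable_residual.norm.pow_const 2).ennreal_ofReal.inv
  filter_upwards [ae_lt_top hm ((lintegral_inv_norm_residual_sq_le hi ht).trans_lt
    ENNReal.ofReal_lt_top).ne] with W hW h0
  simp [h0] at hW

/-- The residual does not involve row `j`. Averaging over that row alone replaces `⟪u, Wⱼ⟫²` by
`‖u‖²` and leaves the expectation of `1/‖u‖²`. -/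
theorem lintegral_inner_residual_le {j : Fin D} (hi : i ∈ t) (hj : j ∉ t)
    (ht : t.card + 2 ≤ Module.finrank ℝ F) :
    ∫⁻ W, ENNReal.ofReal (inner ℝ (residual t i W) (W j) ^ 2) *
        ((ENNReal.ofReal (‖residual t i W‖ ^ 2))⁻¹) ^ 2
        ∂(Measure.pi fun _ : Fin D => stdGaussian F) ≤
      ENNReal.ofReal (1 / ((Module.finrank ℝ F : ℝ) - t.card - 1)) := by
  have hr := measurable_residual (F := F) (t := t) (i := i)
  have hm : Measurable fun W : Fin D → F => ENNReal.ofReal (inner ℝ (residual t i W) (W j) ^ 2) *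
        ((ENNReal.ofReal (‖residual t i W‖ ^ 2))⁻¹) ^ 2 :=
    ((hr.inner (measurable_pi_apply j)).pow_const 2).ennreal_ofReal.mul
      ((hr.norm.pow_const 2).ennreal_ofReal.inv.pow_const 2)
  rw [lintegral_pi_update _ j hm]
  refine le_trans (lintegral_mono fun W => ?_) (lintegral_inv_norm_residual_sq_le hi ht)
  simp only [residual_update W hi hj, Function.update_self]
  -- Where the residual vanishes, `0 · ∞ = 0`, so the cancellation is only an inequality, which is
  -- enough.
  rw [lintegral_mul_const _ (by fun_prop), lintegral_inner_sq_stdGaussian,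
    sq (ENNReal.ofReal _)⁻¹, ← mul_assoc]
  exact mul_le_of_le_one_left' (ENNReal.mul_inv_le_one _)

end residual

/-! ### The randomized range-finder bound. -/

variable {D n : ℕ} {A : Matrix (Fin D) (Fin D) ℝ}

theorem toEuclideanLin_eigenvectorBasis (hA : A.IsHermitian) (i : Fin D) :
    Matrix.toEuclideanLin A (hA.eigenvectorBasis i) =
      hA.eigenvalues i • hA.eigenvectorBasis i := by
  rw [Matrix.toLpLin_apply, hA.mulVec_eigenvectorBasis, WithLp.toLp_smul]

theorem norm_toEuclideanLin_sq (hA : A.IsHermitian) (x : EuclideanSpace ℝ (Fin D)) :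
    ‖Matrix.toEuclideanLin A x‖ ^ 2 =
      ∑ j, hA.eigenvalues j ^ 2 * inner ℝ (hA.eigenvectorBasis j) x ^ 2 := by
  rw [← hA.eigenvectorBasis.sum_sq_inner_right]
  refine Finset.sum_congr rfl fun j _ => ?_
  have hs := (Matrix.isSymmetric_toEuclideanLin_iff.2 hA) (hA.eigenvectorBasis j) x
  rw [← hs, toEuclideanLin_eigenvectorBasis, inner_smul_left]
  simp only [conj_trivial]
  ring

theorem norm_one_sub_mul_eigenvector_sq_le (hA : A.IsHermitian)
    (S : Fin n → EuclideanSpace ℝ (Fin D)) (i : Fin D) :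
    ‖Matrix.toEuclideanLin ((1 - qrFactor A S * (qrFactor A S)ᵀ) * A)
      (hA.eigenvectorBasis i)‖ ^ 2 ≤ hA.eigenvalues i ^ 2 := by
  have h : hA.eigenvalues i ^ 2 =
      ‖Matrix.toEuclideanLin A (hA.eigenvectorBasis i) - 0‖ ^ 2 := by
    rw [sub_zero, toEuclideanLin_eigenvectorBasis, norm_smul]
    simp
  rw [h, toEuclideanLin_one_sub_mul]
  gcongr
  exact norm_sub_starProjection_le _ _ (zero_mem _)

/-- The projection error is at most the distance from `A bᵢ` to any point of the range of `AS`. A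
good competitor is the image of a combination of the sketch vectors that reproduces `bᵢ` on the
coordinates in `t`. -/
theorem norm_one_sub_mul_eigenvector_sq_le_sum (hA : A.IsHermitian)
    (S : Fin n → EuclideanSpace ℝ (Fin D)) {t : Finset (Fin D)} {i : Fin D} (hi : i ∈ t)
    (hu : residual t i (coordRows hA.eigenvectorBasis S) ≠ 0) :
    ‖Matrix.toEuclideanLin ((1 - qrFactor A S * (qrFactor A S)ᵀ) * A)
      (hA.eigenvectorBasis i)‖ ^ 2 ≤
      ∑ j ∈ tᶜ, hA.eigenvalues j ^ 2 *
        (inner ℝ (residual t i (coordRows hA.eigenvectorBasis S))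
            (coordRows hA.eigenvectorBasis S j) ^ 2 *
          ((‖residual t i (coordRows hA.eigenvectorBasis S)‖ ^ 2)⁻¹) ^ 2) := by
  set b := hA.eigenvectorBasis with hb
  set W := coordRows b S with hW
  set u := residual t i W with hu'
  have hu0 : ‖u‖ ^ 2 ≠ 0 := by positivity
  -- With weights `u/‖u‖²`, the coordinate of the combination on `bⱼ` is `⟪Wⱼ,u⟫/‖u‖²`: it is `1`
  -- for `j = i` and `0` for the other `j ∈ t`. Thus `x` has coordinates only outside `t`.
  set x : EuclideanSpace ℝ (Fin D) := b i - ∑ a, (u a * (‖u‖ ^ 2)⁻¹) • S a with hx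
  have hx' : Matrix.toEuclideanLin A (b i) -
      ∑ a, (u a * (‖u‖ ^ 2)⁻¹) • Matrix.toEuclideanLin A (S a) = Matrix.toEuclideanLin A x := by
    rw [hx, map_sub, map_sum]
    simp only [map_smul]
  have hbx : ∀ j, inner ℝ (b j) x = (if j = i then 1 else 0) - inner ℝ (W j) u * (‖u‖ ^ 2)⁻¹ := by
    intro j
    rw [hx, inner_sub_right, orthonormal_iff_ite.1 b.orthonormal, inner_sum, PiLp.inner_apply,
      Finset.sum_mul]
    congr 1
    refine Finset.sum_congr rfl fun a _ => ?_
    rw [inner_smul_right, hW]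
    simp only [coordRows, RCLike.inner_apply, conj_trivial]
    ring
  have hmem : ∑ a, (u a * (‖u‖ ^ 2)⁻¹) • Matrix.toEuclideanLin A (S a) ∈
      Submodule.span ℝ (range fun l => Matrix.toEuclideanLin A (S l)) :=
    sum_mem fun a _ => Submodule.smul_mem _ _ (Submodule.subset_span ⟨a, rfl⟩)
  have hle : ‖Matrix.toEuclideanLin ((1 - qrFactor A S * (qrFactor A S)ᵀ) * A) (b i)‖ ^ 2 ≤
      ‖Matrix.toEuclideanLin A x‖ ^ 2 := by
    rw [toEuclideanLin_one_sub_mul, ← hx']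
    gcongr
    exact norm_sub_starProjection_le _ _ hmem
  refine hle.trans (le_of_eq ?_)
  rw [norm_toEuclideanLin_sq hA, ← Finset.sum_add_sum_compl t, Finset.sum_eq_zero, zero_add]
  · refine Finset.sum_congr rfl fun j hj => ?_
    have hji : j ≠ i := by
      rintro rfl
      exact (Finset.mem_compl.1 hj) hi
    rw [← hb, hbx, if_neg hji, real_inner_comm u]
    ring
  · intro j hj
    rw [← hb, hbx]
    by_cases hji : j = i
    · subst hji
      rw [if_pos rfl, hu', inner_residual_self, ← hu', mul_inv_cancel₀ hu0]
      simp
    · rw [if_neg hji, hu', inner_residual_of_mem W hj hji]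
      simp

theorem lintegral_norm_one_sub_mul_sq_le_of_card (hA : A.IsHermitian) {t : Finset (Fin D)}
    (ht : t.card + 2 ≤ n) :
    ∫⁻ S : Fin n → EuclideanSpace ℝ (Fin D),
        ENNReal.ofReal (‖(1 - qrFactor A S * (qrFactor A S)ᵀ) * A‖ ^ 2)
        ∂(Measure.pi fun _ => stdGaussian (EuclideanSpace ℝ (Fin D))) ≤
      ENNReal.ofReal ((1 + t.card / ((n : ℝ) - t.card - 1)) *
        ∑ j ∈ tᶜ, hA.eigenvalues j ^ 2) := by
  set b := hA.eigenvectorBasis with hb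
  have hfr : Module.finrank ℝ (EuclideanSpace ℝ (Fin n)) = n := by simp
  have hpos : (0 : ℝ) < (n : ℝ) - t.card - 1 := by
    have : (t.card : ℝ) + 2 ≤ n := by exact_mod_cast ht
    linarith
  let ψ : Fin D → Fin D → (Fin D → EuclideanSpace ℝ (Fin n)) → ENNReal := fun i j W =>
    ENNReal.ofReal (inner ℝ (residual t i W) (W j) ^ 2) *
      ((ENNReal.ofReal (‖residual t i W‖ ^ 2))⁻¹) ^ 2
  have hψ : ∀ i j, Measurable (ψ i j) := fun i j =>
    ((measurable_residual.inner (measurable_pi_apply j)).pow_const 2).ennreal_ofReal.mul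
      ((measurable_residual.norm.pow_const 2).ennreal_ofReal.inv.pow_const 2)
  let Ψ : (Fin D → EuclideanSpace ℝ (Fin n)) → ENNReal := fun W =>
    ∑ j ∈ tᶜ, ENNReal.ofReal (hA.eigenvalues j ^ 2) +
      ∑ i ∈ t, ∑ j ∈ tᶜ, ENNReal.ofReal (hA.eigenvalues j ^ 2) * ψ i j W
  have hΨ : Measurable Ψ := measurable_const.add (Finset.measurable_sum _ fun i _ =>
    Finset.measurable_sum _ fun j _ => (hψ i j).const_mul _)
  have hae : ∀ᵐ S ∂(Measure.pi fun _ : Fin n => stdGaussian (EuclideanSpace ℝ (Fin D))),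
      ∀ i ∈ t, residual t i (coordRows b S) ≠ 0 := by
    have h : ∀ᵐ W ∂(Measure.pi fun _ : Fin D => stdGaussian (EuclideanSpace ℝ (Fin n))),
        ∀ i ∈ t, residual t i W ≠ 0 := by
      refine ae_all_iff.2 fun i => ?_
      by_cases hi : i ∈ t
      · filter_upwards [ae_residual_ne_zero hi (by rwa [hfr])] with W hW _ using hW
      · exact ae_of_all _ fun W h => absurd h hi
    rw [← map_coordRows b] at h
    exact ae_of_ae_map (measurable_coordRows b).aemeasurable h
  calc _ ≤ ∫⁻ S : Fin n → EuclideanSpace ℝ (Fin D), Ψ (coordRows b S)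
        ∂(Measure.pi fun _ => stdGaussian (EuclideanSpace ℝ (Fin D))) := by
        refine lintegral_mono_ae ?_
        filter_upwards [hae] with S hS
        -- Eigenvectors outside `t` are charged their full `λⱼ²`, which gives the `1` in the
        -- constant; each of those in `t` is charged through the competitor.
        rw [norm_sq_eq_sum_basis _ b, ← Finset.sum_add_sum_compl t, add_comm,
          ENNReal.ofReal_add (by positivity) (by positivity)]
        refine add_le_add ?_ ?_
        · rw [← ENNReal.ofReal_sum_of_nonneg fun _ _ => sq_nonneg _]
          exact ENNReal.ofReal_le_ofReal (Finset.sum_le_sum fun i _ =>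
            norm_one_sub_mul_eigenvector_sq_le hA S i)
        · rw [ENNReal.ofReal_sum_of_nonneg fun _ _ => sq_nonneg _]
          refine Finset.sum_le_sum fun i hi => ?_
          refine (ENNReal.ofReal_le_ofReal
            (norm_one_sub_mul_eigenvector_sq_le_sum hA S hi (hS i hi))).trans (le_of_eq ?_)
          rw [ENNReal.ofReal_sum_of_nonneg fun _ _ => by positivity]
          refine Finset.sum_congr rfl fun j _ => ?_
          have h0 : 0 < ‖residual t i (coordRows b S)‖ ^ 2 := by
            have := hS i hi
            positivity
          rw [hb] at h0
          rw [ENNReal.ofReal_mul (sq_nonneg _), ENNReal.ofReal_mul (sq_nonneg _),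
            ENNReal.ofReal_pow (inv_nonneg.2 h0.le), ENNReal.ofReal_inv_of_pos h0]
    _ = ∫⁻ W, Ψ W ∂(Measure.pi fun _ : Fin D => stdGaussian (EuclideanSpace ℝ (Fin n))) := by
        rw [← map_coordRows b, lintegral_map hΨ (measurable_coordRows b)]
    _ ≤ ∑ j ∈ tᶜ, ENNReal.ofReal (hA.eigenvalues j ^ 2) +
          ∑ i ∈ t, ∑ j ∈ tᶜ, ENNReal.ofReal (hA.eigenvalues j ^ 2) *
            ENNReal.ofReal (1 / ((n : ℝ) - t.card - 1)) := by
        simp only [Ψ]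
        rw [lintegral_add_left measurable_const, lintegral_const, measure_univ, mul_one,
          lintegral_finsetSum _ fun i _ =>
            Finset.measurable_sum _ fun j _ => (hψ i j).const_mul _]
        gcongr with i hi
        rw [lintegral_finsetSum _ fun j _ => (hψ i j).const_mul _]
        gcongr with j hj
        rw [lintegral_const_mul _ (hψ i j)]
        gcongr
        refine (lintegral_inner_residual_le hi (Finset.mem_compl.1 hj) (by rwa [hfr])).trans ?_
        rw [hfr]
    _ = _ := by
        rw [Finset.sum_const, ← Finset.sum_mul, ← ENNReal.ofReal_sum_of_nonneg fun _ _ =>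
          sq_nonneg _, nsmul_eq_mul, ← ENNReal.ofReal_natCast, ← ENNReal.ofReal_mul (by positivity),
          ← ENNReal.ofReal_mul (by positivity), ← ENNReal.ofReal_add (by positivity)
            (by positivity)]
        congr 1
        ring

theorem lintegral_norm_one_sub_mul_sq_le (hA : A.PosSemidef) (hn : 2 ≤ n) :
    ∫⁻ S : Fin n → EuclideanSpace ℝ (Fin D),
        ENNReal.ofReal (‖(1 - qrFactor A S * (qrFactor A S)ᵀ) * A‖ ^ 2)
        ∂(Measure.pi fun _ => stdGaussian (EuclideanSpace ℝ (Fin D))) ≤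
      ENNReal.ofReal (A.trace ^ 2 / ((n : ℝ) - 1)) := by
  classical
  have hH := hA.isHermitian
  have hσ : ∀ i, 0 ≤ hH.eigenvalues i := hA.eigenvalues_nonneg
  have htr : A.trace = ∑ i, hH.eigenvalues i := by
    rw [hH.trace_eq_sum_eigenvalues]; simp
  have hN : (1 : ℝ) ≤ (n : ℝ) - 1 := by
    have : (2 : ℝ) ≤ n := by exact_mod_cast hn
    linarith
  set N : ℝ := (n : ℝ) - 1 with hNdef
  -- The strict threshold forces `t.card < n - 1`, because the eigenvalues sum to the trace. If the
  -- trace is zero, `t` is empty.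
  set t : Finset (Fin D) := Finset.univ.filter fun i => A.trace / N < hH.eigenvalues i with ht
  have htr0 : 0 ≤ A.trace := hA.trace_nonneg
  have hsplit : ∑ i ∈ t, hH.eigenvalues i + ∑ i ∈ tᶜ, hH.eigenvalues i = A.trace := by
    rw [htr, Finset.sum_add_sum_compl]
  have hcompl : 0 ≤ ∑ i ∈ tᶜ, hH.eigenvalues i := Finset.sum_nonneg fun i _ => hσ i
  have hsum : t.card * (A.trace / N) ≤ ∑ i ∈ t, hH.eigenvalues i := by
    rw [← nsmul_eq_mul]
    exact Finset.card_nsmul_le_sum _ _ _ fun i hi => (Finset.mem_filter.1 hi).2.le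
  have hcard : (t.card : ℝ) < N := by
    rcases t.eq_empty_or_nonempty with h0 | h0
    · rw [h0]; simp; linarith
    · have h1 : t.card * (A.trace / N) < ∑ i ∈ t, hH.eigenvalues i := by
        rw [← nsmul_eq_mul, ← Finset.sum_const]
        exact Finset.sum_lt_sum_of_nonempty h0 fun i hi => (Finset.mem_filter.1 hi).2
      have h2 : t.card * (A.trace / N) < A.trace := by linarith
      rw [← mul_div_assoc, div_lt_iff₀ (by linarith), mul_comm] at h2
      exact lt_of_mul_lt_mul_left h2 htr0
  have hcard' : t.card + 2 ≤ n := by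
    have : (t.card : ℝ) + 1 < n := by linarith
    have : t.card + 1 < n := by exact_mod_cast this
    omega
  refine (lintegral_norm_one_sub_mul_sq_le_of_card hH hcard').trans (ENNReal.ofReal_le_ofReal ?_)
  have hτ : ∑ j ∈ tᶜ, hH.eigenvalues j ^ 2 ≤
      A.trace / N * (A.trace - t.card * (A.trace / N)) := by
    calc _ ≤ ∑ j ∈ tᶜ, A.trace / N * hH.eigenvalues j := by
          refine Finset.sum_le_sum fun j hj => ?_
          have : hH.eigenvalues j ≤ A.trace / N := by
            simpa [ht] using hj
          rw [sq]
          exact mul_le_mul_of_nonneg_right this (hσ j)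
      _ ≤ _ := by
          rw [← Finset.mul_sum]
          gcongr
          linarith
  have hNt : 0 < N - t.card := by linarith
  have h1 : (n : ℝ) - t.card - 1 = N - t.card := by rw [hNdef]; ring
  rw [h1]
  -- With `τ = Tr A/N` and `k = t.card`, the tail is at most `τ²(N-k)` and the prefactor is
  -- `N/(N-k)`, so `k` cancels and `τ²N` remains.
  calc _ ≤ (1 + t.card / (N - t.card)) * (A.trace / N * (A.trace - t.card * (A.trace / N))) := by
        gcongr
    _ = _ := by
        field_simp
        ring

/-! ### Regularity of the Jacobian along the trajectory. -/

theorem norm_le_sum_abs {m n : Type*} [Fintype m] [Fintype n] (B : Matrix m n ℝ) :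
    ‖B‖ ≤ ∑ i, ∑ j, |B i j| := by
  refine le_of_sq_le_sq ?_ (by positivity)
  rw [norm_sq_eq_sum]
  simp_rw [← sq_abs (B _ _), ← Fintype.sum_prod_type']
  exact Finset.sum_sq_le_sq_sum_of_nonneg fun p _ => abs_nonneg _

theorem abs_entry_le_norm {m n : Type*} [Fintype m] [Fintype n] (B : Matrix m n ℝ) (i : m)
    (j : n) : |B i j| ≤ ‖B‖ := by
  refine abs_le_of_sq_le_sq' ?_ (norm_nonneg _) |> abs_le.2
  rw [norm_sq_eq_sum]
  exact (Finset.single_le_sum (f := fun j => B i j ^ 2) (fun _ _ => sq_nonneg _)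
    (Finset.mem_univ j)).trans (Finset.single_le_sum (f := fun i => ∑ j, B i j ^ 2)
      (fun _ _ => Finset.sum_nonneg fun _ _ => sq_nonneg _) (Finset.mem_univ i))

theorem exists_lipschitzOnWith_of_contDiffOn_Icc {a b : ℝ} (hab : a < b) {g : ℝ → ℝ}
    (hg : ContDiffOn ℝ 1 g (Icc a b)) : ∃ K : ℝ≥0, LipschitzOnWith K g (Icc a b) := by
  have hu := uniqueDiffOn_Icc hab
  obtain ⟨C, hC⟩ := isCompact_Icc.exists_bound_of_continuousOn
    (hg.continuousOn_derivWithin hu le_rfl)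
  refine ⟨C.toNNReal, (convex_Icc a b).lipschitzOnWith_of_nnnorm_derivWithin_le
    (hg.differentiableOn one_ne_zero) fun x hx => ?_⟩
  rw [← NNReal.coe_le_coe, coe_nnnorm]
  exact (hC x hx).trans (Real.le_coe_toNNReal C)

section trajectory

variable {D : ℕ} {f : EuclideanSpace ℝ (Fin D) → ℝ → EuclideanSpace ℝ (Fin D)}
  {z : ℝ → EuclideanSpace ℝ (Fin D)} {T : ℝ}

theorem contDiffOn_trajectory (hT : 0 < T)
    (hf : ContDiffOn ℝ 2 (fun p : EuclideanSpace ℝ (Fin D) × ℝ => f p.1 p.2)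
      (univ ×ˢ Icc (0 : ℝ) T))
    (hz : ∀ t ∈ Icc (0 : ℝ) T, HasDerivWithinAt z (f (z t) t) (Icc (0 : ℝ) T) t) :
    ContDiffOn ℝ 1 z (Icc 0 T) := by
  have hu := uniqueDiffOn_Icc hT
  rw [contDiffOn_one_iff_derivWithin hu]
  refine ⟨fun t ht => (hz t ht).differentiableWithinAt, ?_⟩
  have hzc : ContinuousOn z (Icc 0 T) := fun t ht => (hz t ht).continuousWithinAt
  have : ContinuousOn (fun t => f (z t) t) (Icc 0 T) :=
    hf.continuousOn.comp (f := fun t => (z t, t)) (hzc.prodMk continuousOn_id)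
      fun t ht => ⟨mem_univ _, ht⟩
  exact this.congr fun t ht => (hz t ht).derivWithin (hu t ht)

/-- The slice at a fixed time is the whole space, so the ordinary spatial derivative agrees with the
joint derivative within the strip, even at the endpoint times. -/
theorem jacobian_apply_eq
    (hf : ContDiffOn ℝ 2 (fun p : EuclideanSpace ℝ (Fin D) × ℝ => f p.1 p.2)
      (univ ×ˢ Icc (0 : ℝ) T)) {t : ℝ} (ht : t ∈ Icc 0 T) (i j : Fin D) :
    jacobian f z t i j =
      (fderivWithin ℝ (fun p : EuclideanSpace ℝ (Fin D) × ℝ => f p.1 p.2) (univ ×ˢ Icc (0 : ℝ) T)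
        (z t, t) (EuclideanSpace.single j 1, 0)).ofLp i := by
  have h1 := ((hf.differentiableOn two_ne_zero) (z t, t) ⟨mem_univ _, ht⟩).hasFDerivWithinAt
  have h2 : HasFDerivWithinAt (fun x : EuclideanSpace ℝ (Fin D) => (x, t))
      (ContinuousLinearMap.inl ℝ (EuclideanSpace ℝ (Fin D)) ℝ) univ (z t) :=
    (hasFDerivAt_prodMk_left (z t) t).hasFDerivWithinAt
  have h3 := h1.comp (z t) h2 fun x _ =>
    (⟨mem_univ _, ht⟩ : (x, t) ∈ (univ : Set (EuclideanSpace ℝ (Fin D))) ×ˢ Icc (0 : ℝ) T)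
  rw [hasFDerivWithinAt_univ] at h3
  have h4 : fderiv ℝ (fun x => f x t) (z t) = _ := h3.fderiv
  rw [jacobian, Matrix.of_apply, h4]
  simp

/-- The equation makes `z` of class `C¹`. The derivative of `f` is `C¹` as well, so each entry is
`C¹` on a compact interval. -/
theorem exists_lipschitzOnWith_jacobian (hT : 0 < T)
    (hf : ContDiffOn ℝ 2 (fun p : EuclideanSpace ℝ (Fin D) × ℝ => f p.1 p.2)
      (univ ×ˢ Icc (0 : ℝ) T))
    (hz : ∀ t ∈ Icc (0 : ℝ) T, HasDerivWithinAt z (f (z t) t) (Icc (0 : ℝ) T) t) :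
    ∃ K : ℝ≥0, LipschitzOnWith K (jacobian f z) (Icc (0 : ℝ) T) := by
  have hu : UniqueDiffOn ℝ ((univ : Set (EuclideanSpace ℝ (Fin D))) ×ˢ Icc (0 : ℝ) T) :=
    uniqueDiffOn_univ.prod (uniqueDiffOn_Icc hT)
  have hzc := contDiffOn_trajectory hT hf hz
  have hF := (hf.fderivWithin hu (m := 1) (by norm_num)).comp (f := fun t => (z t, t))
    (hzc.prodMk contDiffOn_id) fun t ht => ⟨mem_univ _, ht⟩
  have hent : ∀ i j, ∃ K : ℝ≥0, LipschitzOnWith K (fun t => jacobian f z t i j) (Icc 0 T) := by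
    intro i j
    refine exists_lipschitzOnWith_of_contDiffOn_Icc hT ?_
    have h1 : ContDiffOn ℝ 1 (fun t => (fderivWithin ℝ
        (fun p : EuclideanSpace ℝ (Fin D) × ℝ => f p.1 p.2) (univ ×ˢ Icc (0 : ℝ) T)
        (z t, t) (EuclideanSpace.single j 1, 0))) (Icc 0 T) := hF.clm_apply contDiffOn_const
    have h2 := (contDiffOn_euclidean.1 h1) i
    exact h2.congr fun t ht => jacobian_apply_eq hf ht i j
  choose K hK using hent
  refine ⟨∑ i, ∑ j, K i j, LipschitzOnWith.of_dist_le_mul fun s hs t ht => ?_⟩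
  rw [dist_eq_norm]
  refine (norm_le_sum_abs _).trans ?_
  push_cast
  simp only [Finset.sum_mul]
  refine Finset.sum_le_sum fun i _ => Finset.sum_le_sum fun j _ => ?_
  exact (hK i j).dist_le_mul s hs t ht

theorem continuousOn_jacobian_apply {K : ℝ≥0} {s : Set ℝ}
    (hK : LipschitzOnWith K (jacobian f z) s) (i j : Fin D) :
    ContinuousOn (fun t => jacobian f z t i j) s := by
  refine LipschitzOnWith.continuousOn (K := K)
    (LipschitzOnWith.of_dist_le_mul fun a ha b hb => ?_)
  refine le_trans ?_ (hK.dist_le_mul a ha b hb)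
  rw [dist_eq_norm, dist_eq_norm, Real.norm_eq_abs]
  exact abs_entry_le_norm (jacobian f z a - jacobian f z b) i j

theorem continuousOn_trace_jacobian {K : ℝ≥0} {s : Set ℝ}
    (hK : LipschitzOnWith K (jacobian f z) s) :
    ContinuousOn (fun t => (jacobian f z t).trace) s :=
  continuousOn_finsetSum _ fun i _ => continuousOn_jacobian_apply hK i i

theorem exists_isGreatest_abs_trace (hT : 0 ≤ T) {K : ℝ≥0}
    (hK : LipschitzOnWith K (jacobian f z) (Icc 0 T)) :
    ∃ M : ℝ, IsGreatest ((fun t => |(jacobian f z t).trace|) '' Icc (0 : ℝ) T) M :=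
  (isCompact_Icc.image_of_continuousOn (continuousOn_trace_jacobian hK).abs).exists_isGreatest
    ((nonempty_Icc.2 hT).image _)

end trajectory

/-! ### Age of the frozen factor. -/

section updateTime

variable {T η : ℝ} {Ls : ℕ} {t : ℝ}

theorem measurable_updateTime (T η : ℝ) (Ls : ℕ) : Measurable (updateTime T η Ls) := by
  unfold updateTime
  by_cases h : Ls = 1
  · simp [h, measurable_id']
  · simp only [h, false_or]
    refine Measurable.ite (measurableSet_singleton T) measurable_id ?_
    exact ((measurable_from_top (f := fun k : ℕ => (k : ℝ))).comp
      (Nat.measurable_floor.comp (measurable_id.div_const _))).mul_const _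

theorem updateTime_mem_Icc (hη : 0 ≤ η) (ht : t ∈ Icc 0 T) : updateTime T η Ls t ∈ Icc 0 T := by
  unfold updateTime
  split_ifs with h
  · exact ht
  · have h0 : 0 ≤ (Ls : ℝ) * η := by positivity
    refine ⟨by positivity, le_trans ?_ ht.2⟩
    rcases h0.eq_or_lt with h1 | h1
    · rw [← h1]; simpa using ht.1
    · exact (le_div_iff₀ h1).1 (Nat.floor_le (div_nonneg ht.1 h0))

/-- Within a block the age is below `Ls·η`, and `Ls ≤ 2(Ls-1)` as soon as `Ls ≥ 2`. This is the
source of the `2`; for `Ls = 1` the age is zero. -/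
theorem abs_sub_updateTime_le (hη : 0 < η) (hLs : 1 ≤ Ls) (ht : 0 ≤ t) :
    |t - updateTime T η Ls t| ≤ 2 * ((Ls : ℝ) - 1) * η := by
  have hLs' : (1 : ℝ) ≤ Ls := by exact_mod_cast hLs
  have hR : 0 ≤ 2 * ((Ls : ℝ) - 1) * η := by
    have : 0 ≤ (Ls : ℝ) - 1 := by linarith
    positivity
  unfold updateTime
  split_ifs with h
  · simpa using hR
  · have h2 : (2 : ℝ) ≤ Ls := by
      have : 2 ≤ Ls := by
        have : Ls ≠ 1 := fun h' => h (Or.inl h')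
        omega
      exact_mod_cast this
    have h1 : 0 < (Ls : ℝ) * η := by positivity
    have h3 := (le_div_iff₀ h1).1 (Nat.floor_le (div_nonneg ht h1.le))
    have h4 := (div_lt_iff₀ h1).1 (Nat.lt_floor_add_one (t / (Ls * η)))
    rw [abs_of_nonneg (by linarith)]
    nlinarith

end updateTime

/-! ### The estimator at a fixed time. -/

section estimator

variable {D n : ℕ} {A B : Matrix (Fin D) (Fin D) ℝ}

theorem isHermitian_deflate (A : Matrix (Fin D) (Fin D) ℝ) (hB : B.IsHermitian)
    (S : Fin n → EuclideanSpace ℝ (Fin D)) :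
    ((1 - qrFactor A S * (qrFactor A S)ᵀ) * B *
      (1 - qrFactor A S * (qrFactor A S)ᵀ)).IsHermitian := by
  have hBt : Bᵀ = B := by simpa using hB.eq
  rw [Matrix.IsHermitian, Matrix.conjTranspose_eq_transpose_of_trivial, Matrix.transpose_mul,
    Matrix.transpose_mul, Matrix.transpose_sub, qrFactor_mul_transpose_symm, Matrix.transpose_one,
    hBt, mul_assoc]

/-- The right projector is discarded as a contraction. The left one is kept on `A`, whose range was
sketched, and discarded on the drift `B - A`. -/
theorem norm_deflate_le (A B : Matrix (Fin D) (Fin D) ℝ) (S : Fin n → EuclideanSpace ℝ (Fin D)) :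
    ‖(1 - qrFactor A S * (qrFactor A S)ᵀ) * B * (1 - qrFactor A S * (qrFactor A S)ᵀ)‖ ≤
      ‖(1 - qrFactor A S * (qrFactor A S)ᵀ) * A‖ + ‖B - A‖ := by
  refine (norm_mul_one_sub_le A S _).trans ?_
  have h : (1 - qrFactor A S * (qrFactor A S)ᵀ) * B =
      (1 - qrFactor A S * (qrFactor A S)ᵀ) * A +
        (1 - qrFactor A S * (qrFactor A S)ᵀ) * (B - A) := by
    rw [← mul_add, add_sub_cancel]
  rw [h]
  exact (norm_add_le _ _).trans (add_le_add le_rfl (norm_one_sub_mul_le A S _))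

theorem approxHutchPP_sub_trace (A B : Matrix (Fin D) (Fin D) ℝ)
    (S G : Fin n → EuclideanSpace ℝ (Fin D)) :
    approxHutchPP A B S G - B.trace =
      hutchinson G ((1 - qrFactor A S * (qrFactor A S)ᵀ) * B *
        (1 - qrFactor A S * (qrFactor A S)ᵀ)) -
      ((1 - qrFactor A S * (qrFactor A S)ᵀ) * B *
        (1 - qrFactor A S * (qrFactor A S)ᵀ)).trace := by
  rw [approxHutchPP, ← trace_add_trace A S B]
  ring

theorem measurable_approxHutchPP_prod (A B : Matrix (Fin D) (Fin D) ℝ) :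
    Measurable fun p : (Fin n → EuclideanSpace ℝ (Fin D)) × (Fin n → EuclideanSpace ℝ (Fin D)) =>
      approxHutchPP A B p.1 p.2 :=
  measurable_approxHutchPP (fun _ _ => measurable_const) (fun _ _ => measurable_const)
    (fun l => (measurable_pi_apply l).comp measurable_fst)
    (fun l => (measurable_pi_apply l).comp measurable_snd)

/-- The joint law of two independent families of `n` standard Gaussian vectors. -/
noncomputable abbrev gaussianPairs (D n : ℕ) :
    Measure ((Fin n → EuclideanSpace ℝ (Fin D)) × (Fin n → EuclideanSpace ℝ (Fin D))) :=
  (Measure.pi fun _ => stdGaussian (EuclideanSpace ℝ (Fin D))).prod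
    (Measure.pi fun _ => stdGaussian (EuclideanSpace ℝ (Fin D)))

theorem lintegral_approxHutchPP_sub_trace_sq_le (hn : 2 ≤ n) (hA : A.PosSemidef)
    (hB : B.IsHermitian) :
    ∫⁻ p, ENNReal.ofReal ((approxHutchPP A B p.1 p.2 - B.trace) ^ 2) ∂gaussianPairs D n ≤
      ENNReal.ofReal (4 / n * (A.trace ^ 2 / ((n : ℝ) - 1) + ‖B - A‖ ^ 2)) := by
  have hN : (0 : ℝ) < (n : ℝ) - 1 := by
    have : (2 : ℝ) ≤ n := by exact_mod_cast hn
    linarith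
  have hm : Measurable fun p : (Fin n → EuclideanSpace ℝ (Fin D)) ×
      (Fin n → EuclideanSpace ℝ (Fin D)) =>
      ENNReal.ofReal ((approxHutchPP A B p.1 p.2 - B.trace) ^ 2) :=
    (((measurable_approxHutchPP_prod A B).sub_const _).pow_const 2).ennreal_ofReal
  rw [lintegral_prod _ hm.aemeasurable]
  calc _ ≤ ∫⁻ S : Fin n → EuclideanSpace ℝ (Fin D), (ENNReal.ofReal (4 / n) *
          ENNReal.ofReal (‖(1 - qrFactor A S * (qrFactor A S)ᵀ) * A‖ ^ 2) +
          ENNReal.ofReal (4 / n * ‖B - A‖ ^ 2))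
        ∂(Measure.pi fun _ => stdGaussian (EuclideanSpace ℝ (Fin D))) := by
        refine lintegral_mono fun S => ?_
        simp only [approxHutchPP_sub_trace]
        rw [lintegral_hutchinson_sub_trace_sq (by omega) (isHermitian_deflate A hB S),
          ← ENNReal.ofReal_mul (by positivity), ← ENNReal.ofReal_add (by positivity)
            (by positivity)]
        refine ENNReal.ofReal_le_ofReal ?_
        have h := norm_deflate_le A B S
        -- From `(a+b)² ≤ 2a² + 2b²`; this turns the Hutchinson factor `2/n` into `4/n`.
        have h2 : ‖(1 - qrFactor A S * (qrFactor A S)ᵀ) * B *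
            (1 - qrFactor A S * (qrFactor A S)ᵀ)‖ ^ 2 ≤
            2 * ‖(1 - qrFactor A S * (qrFactor A S)ᵀ) * A‖ ^ 2 + 2 * ‖B - A‖ ^ 2 := by
          refine (pow_le_pow_left₀ (norm_nonneg _) h 2).trans ?_
          nlinarith [sq_nonneg (‖(1 - qrFactor A S * (qrFactor A S)ᵀ) * A‖ - ‖B - A‖)]
        calc _ ≤ 2 / (n : ℝ) * (2 * ‖(1 - qrFactor A S * (qrFactor A S)ᵀ) * A‖ ^ 2 +
              2 * ‖B - A‖ ^ 2) := by gcongr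
          _ = _ := by ring
    _ ≤ _ := by
        rw [lintegral_add_right _ measurable_const, lintegral_const, measure_univ, mul_one,
          lintegral_const_mul' _ _ ENNReal.ofReal_ne_top, mul_add (4 / (n : ℝ)),
          ENNReal.ofReal_add (by positivity) (by positivity)]
        rw [ENNReal.ofReal_mul (p := 4 / (n : ℝ)) (q := A.trace ^ 2 / _) (by positivity)]
        gcongr
        exact lintegral_norm_one_sub_mul_sq_le hA hn

theorem memLp_approxHutchPP (hn : 2 ≤ n) (hA : A.PosSemidef) (hB : B.IsHermitian) :
    MemLp (fun p => approxHutchPP A B p.1 p.2) 2 (gaussianPairs D n) := by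
  have h : MemLp (fun p => approxHutchPP A B p.1 p.2 - B.trace) 2 (gaussianPairs D n) := by
    have hm := (measurable_approxHutchPP_prod (n := n) A B).sub_const B.trace
    rw [memLp_two_iff_integrable_sq hm.aestronglyMeasurable]
    refine ⟨(hm.pow_const 2).aestronglyMeasurable, ?_⟩
    rw [hasFiniteIntegral_iff_ofReal (ae_of_all _ fun p => sq_nonneg _)]
    exact (lintegral_approxHutchPP_sub_trace_sq_le hn hA hB).trans_lt ENNReal.ofReal_lt_top
  have h2 := h.add (memLp_const B.trace)
  refine h2.congr_norm (measurable_approxHutchPP_prod A B).aestronglyMeasurable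
    (ae_of_all _ fun p => ?_)
  simp

theorem integral_approxHutchPP (hn : 2 ≤ n) (hA : A.PosSemidef) (hB : B.IsHermitian) :
    ∫ p, approxHutchPP A B p.1 p.2 ∂gaussianPairs D n = B.trace := by
  rw [integral_prod _ ((memLp_approxHutchPP hn hA hB).integrable (by norm_num))]
  have h : ∀ S : Fin n → EuclideanSpace ℝ (Fin D), ∫ G : Fin n → EuclideanSpace ℝ (Fin D),
      approxHutchPP A B S G ∂(Measure.pi fun _ => stdGaussian (EuclideanSpace ℝ (Fin D))) =
      B.trace := by
    intro S
    have hR := isHermitian_deflate A hB S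
    simp only [approxHutchPP]
    rw [integral_add (integrable_const _) ((memLp_hutchinson hR).integrable (by norm_num)),
      integral_hutchinson (by omega) hR]
    simp [trace_add_trace A S B]
  simp only [h]
  simp

theorem abs_trace_le (B : Matrix (Fin D) (Fin D) ℝ) : |B.trace| ≤ D * ‖B‖ := by
  refine (Finset.abs_sum_le_sum_abs _ _).trans ?_
  refine (Finset.sum_le_sum fun i _ => abs_entry_le_norm B i i).trans (le_of_eq ?_)
  simp

theorem abs_hutchinson_le (G : Fin n → EuclideanSpace ℝ (Fin D)) (B : Matrix (Fin D) (Fin D) ℝ) :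
    |hutchinson G B| ≤ (1 / n * ∑ l, ∑ i, ∑ j, |G l i| * |G l j|) * ‖B‖ := by
  rw [hutchinson, abs_mul, abs_of_nonneg (by positivity : (0 : ℝ) ≤ 1 / n), mul_assoc]
  gcongr
  rw [Finset.sum_mul]
  refine (Finset.abs_sum_le_sum_abs _ _).trans (Finset.sum_le_sum fun l _ => ?_)
  simp only [dotProduct, Matrix.mulVec, Finset.mul_sum, Finset.sum_mul]
  refine (Finset.abs_sum_le_sum_abs _ _).trans (Finset.sum_le_sum fun i _ => ?_)
  refine (Finset.abs_sum_le_sum_abs _ _).trans (Finset.sum_le_sum fun j _ => ?_)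
  rw [abs_mul, abs_mul, mul_assoc, mul_comm |B i j|]
  gcongr
  exact abs_entry_le_norm B i j

/-- The bound does not depend on `A`. For each realization it controls the integrand over time
although `Q` may jump. -/
theorem abs_approxHutchPP_le (A B : Matrix (Fin D) (Fin D) ℝ)
    (S G : Fin n → EuclideanSpace ℝ (Fin D)) :
    |approxHutchPP A B S G| ≤
      (2 * D + 1 / n * ∑ l, ∑ i, ∑ j, |G l i| * |G l j|) * ‖B‖ := by
  set R := (1 - qrFactor A S * (qrFactor A S)ᵀ) * B *
        (1 - qrFactor A S * (qrFactor A S)ᵀ) with hR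
  have h : approxHutchPP A B S G = B.trace + (hutchinson G R - R.trace) := by
    rw [← approxHutchPP_sub_trace]; ring
  have hRB : ‖R‖ ≤ ‖B‖ := (norm_mul_one_sub_le A S _).trans (norm_one_sub_mul_le A S _)
  have h1 := abs_trace_le B
  have h2 : |R.trace| ≤ D * ‖B‖ := (abs_trace_le R).trans (by gcongr)
  have h3 : |hutchinson G R| ≤ (1 / n * ∑ l, ∑ i, ∑ j, |G l i| * |G l j|) * ‖B‖ :=
    (abs_hutchinson_le G R).trans (by gcongr)
  rw [h]
  refine (abs_add_le _ _).trans ?_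
  have h4 := abs_sub (hutchinson G R) R.trace
  linarith

end estimator

/-! ### Integrating a random process over time. -/

section timeIntegral

variable {α : Type*} [MeasurableSpace α]

/-- Cauchy–Schwarz against the constant `1`. No integrability is needed, since a non-integrable `g`
has integral zero by convention. -/
theorem ofReal_intervalIntegral_sq_le {t : ℝ} (ht : 0 ≤ t) {g : ℝ → ℝ} (hg : Measurable g) :
    ENNReal.ofReal ((∫ s in (0 : ℝ)..t, g s) ^ 2) ≤
      ENNReal.ofReal t * ∫⁻ s in Ioc 0 t, ENNReal.ofReal (g s ^ 2) := by
  rw [intervalIntegral.integral_of_le ht]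
  have h1 : ENNReal.ofReal ((∫ s in Ioc 0 t, g s) ^ 2) = ‖∫ s in Ioc 0 t, g s‖ₑ ^ 2 := by
    rw [← sq_abs, ENNReal.ofReal_pow (abs_nonneg _), Real.enorm_eq_ofReal_abs]
  have h2 : ‖∫ s in Ioc 0 t, g s‖ₑ ≤ ∫⁻ s in Ioc 0 t, ‖g s‖ₑ * 1 := by
    simpa using enorm_integral_le_lintegral_enorm (μ := volume.restrict (Ioc 0 t)) g
  have h3 := ENNReal.lintegral_mul_le_Lp_mul_Lq (volume.restrict (Ioc 0 t))
    Real.HolderConjugate.two_two (f := fun s => ‖g s‖ₑ) (g := fun _ => 1)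
    hg.enorm.aemeasurable aemeasurable_const
  rw [h1]
  refine (pow_le_pow_left' (h2.trans h3) 2).trans (le_of_eq ?_)
  rw [mul_pow, ← ENNReal.rpow_natCast, ← ENNReal.rpow_natCast, ← ENNReal.rpow_mul,
    ← ENNReal.rpow_mul]
  norm_num
  rw [mul_comm]
  congr 1
  refine lintegral_congr fun s => ?_
  rw [Real.enorm_eq_ofReal_abs, ← ENNReal.ofReal_pow (abs_nonneg _), sq_abs]

/-- Nothing is assumed on the correlation between times. The uniform second-moment bound puts the
centred process in `L²` of the product measure, which justifies both the exchange of integrals for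
the mean and the variance bound. -/
theorem memLp_intervalIntegral {ν : Measure α} [IsProbabilityMeasure ν] {h : ℝ → α → ℝ}
    {c : ℝ → ℝ} {t b : ℝ} (ht : 0 ≤ t) (hb : 0 ≤ b) (hh : Measurable fun p : ℝ × α => h p.1 p.2)
    (hc : Measurable c)
    (hhi : ∀ a, IntervalIntegrable (fun s => h s a) volume 0 t)
    (hci : IntervalIntegrable c volume 0 t)
    (hmean : ∀ s ∈ Ioc 0 t, ∫ a, h s a ∂ν = c s)
    (hvar : ∀ s ∈ Ioc 0 t, ∫⁻ a, ENNReal.ofReal ((h s a - c s) ^ 2) ∂ν ≤ ENNReal.ofReal b) :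
    MemLp (fun a => ∫ s in (0 : ℝ)..t, h s a) 2 ν ∧
      ∫ a, (∫ s in (0 : ℝ)..t, h s a) ∂ν = ∫ s in (0 : ℝ)..t, c s ∧
      variance (fun a => ∫ s in (0 : ℝ)..t, h s a) ν ≤ t ^ 2 * b := by
  set k : ℝ → α → ℝ := fun s a => h s a - c s with hk
  have hkm : Measurable fun p : ℝ × α => k p.1 p.2 := hh.sub (hc.comp measurable_fst)
  have hkm2 : Measurable fun p : ℝ × α => ENNReal.ofReal (k p.1 p.2 ^ 2) :=
    (hkm.pow_const 2).ennreal_ofReal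
  have hY : ∀ a, ∫ s in (0 : ℝ)..t, k s a = (∫ s in (0 : ℝ)..t, h s a) - ∫ s in (0 : ℝ)..t, c s :=
    fun a => intervalIntegral.integral_sub (hhi a) hci
  have htotal : ∫⁻ s in Ioc 0 t, ∫⁻ a, ENNReal.ofReal (k s a ^ 2) ∂ν ≤
      ENNReal.ofReal (t * b) := by
    refine (setLIntegral_mono measurable_const hvar).trans (le_of_eq ?_)
    rw [lintegral_const, Measure.restrict_apply_univ, Real.volume_Ioc, sub_zero,
      ← ENNReal.ofReal_mul hb, mul_comm]
  have hkmem : MemLp (fun p : ℝ × α => k p.1 p.2) 2 ((volume.restrict (Ioc 0 t)).prod ν) := by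
    rw [memLp_two_iff_integrable_sq hkm.aestronglyMeasurable]
    refine ⟨(hkm.pow_const 2).aestronglyMeasurable, ?_⟩
    rw [hasFiniteIntegral_iff_ofReal (ae_of_all _ fun p => sq_nonneg _),
      lintegral_prod _ hkm2.aemeasurable]
    exact htotal.trans_lt ENNReal.ofReal_lt_top
  have hkint : Integrable (fun p : ℝ × α => k p.1 p.2) ((volume.restrict (Ioc 0 t)).prod ν) :=
    hkmem.integrable (by norm_num)
  have hYm : AEStronglyMeasurable (fun a => ∫ s in (0 : ℝ)..t, k s a) ν := by
    simp only [intervalIntegral.integral_of_le ht]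
    exact hkint.swap.integral_prod_left.aestronglyMeasurable
  have hY2 : ∫⁻ a, ENNReal.ofReal ((∫ s in (0 : ℝ)..t, k s a) ^ 2) ∂ν ≤
      ENNReal.ofReal (t ^ 2 * b) := by
    calc _ ≤ ∫⁻ a, ENNReal.ofReal t * (∫⁻ s in Ioc 0 t, ENNReal.ofReal (k s a ^ 2)) ∂ν :=
          lintegral_mono fun a => ofReal_intervalIntegral_sq_le ht
            (hkm.comp (measurable_id.prodMk measurable_const))
      _ = ENNReal.ofReal t * ∫⁻ s in Ioc 0 t, ∫⁻ a, ENNReal.ofReal (k s a ^ 2) ∂ν := by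
          rw [lintegral_const_mul' _ _ ENNReal.ofReal_ne_top]
          congr 1
          exact lintegral_lintegral_swap (f := fun a s => ENNReal.ofReal (k s a ^ 2))
            (hkm2.comp measurable_swap).aemeasurable
      _ ≤ ENNReal.ofReal t * ENNReal.ofReal (t * b) := by gcongr
      _ = _ := by rw [← ENNReal.ofReal_mul ht]; congr 1; ring
  have hYmem : MemLp (fun a => ∫ s in (0 : ℝ)..t, k s a) 2 ν := by
    rw [memLp_two_iff_integrable_sq hYm]
    refine ⟨hYm.pow 2, ?_⟩
    rw [hasFiniteIntegral_iff_ofReal (ae_of_all _ fun p => sq_nonneg _)]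
    exact hY2.trans_lt ENNReal.ofReal_lt_top
  have hXY : (fun a => ∫ s in (0 : ℝ)..t, h s a) =
      fun a => (∫ s in (0 : ℝ)..t, k s a) + ∫ s in (0 : ℝ)..t, c s := by
    funext a; rw [hY]; ring
  have hY0 : ∫ a, (∫ s in (0 : ℝ)..t, k s a) ∂ν = 0 := by
    simp only [intervalIntegral.integral_of_le ht]
    rw [integral_integral_swap (f := fun a s => k s a) hkint.swap]
    have : ∀ᵐ s ∂volume.restrict (Ioc 0 t), ∫ a, k s a ∂ν = 0 := by
      filter_upwards [hkint.prod_right_ae, ae_restrict_mem measurableSet_Ioc] with s hs hst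
      have hint : Integrable (h s) ν := by
        have := hs.add (integrable_const (c s))
        refine this.congr (ae_of_all _ fun a => ?_)
        simp [hk]
      simp only [hk]
      rw [integral_sub hint (integrable_const _), hmean s hst]
      simp
    rw [integral_congr_ae this]
    simp
  refine ⟨?_, ?_, ?_⟩
  · rw [hXY]
    exact hYmem.add (memLp_const _)
  · rw [hXY, integral_add (hYmem.integrable (by norm_num)) (integrable_const _), hY0]
    simp
  · rw [hXY, variance_add_const hYm]
    rw [← ENNReal.ofReal_le_ofReal_iff (by positivity), hYmem.ofReal_variance_eq,
      evariance_eq_lintegral_ofReal, hY0]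
    simpa using hY2

end timeIntegral

/-! ### Moments of the frozen estimator. -/

section frozen

variable {D n : ℕ} {f : EuclideanSpace ℝ (Fin D) → ℝ → EuclideanSpace ℝ (Fin D)}
  {z : ℝ → EuclideanSpace ℝ (Fin D)} {T η : ℝ} {Ls : ℕ}

theorem hasLaw_gaussianPairs {Ω : Type*} [MeasurableSpace Ω] {P : Measure Ω}
    [IsProbabilityMeasure P] {S G : Fin n → Ω → EuclideanSpace ℝ (Fin D)}
    (hS : ∀ i, HasLaw (S i) (stdGaussian (EuclideanSpace ℝ (Fin D))) P)
    (hG : ∀ i, HasLaw (G i) (stdGaussian (EuclideanSpace ℝ (Fin D))) P)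
    (hSG : iIndepFun (Sum.elim S G) P) :
    HasLaw (fun ω => ((fun i => S i ω), fun i => G i ω)) (gaussianPairs D n) P := by
  have h := iIndepFun.hasLaw_pi (μ := fun _ => stdGaussian (EuclideanSpace ℝ (Fin D)))
    (X := Sum.elim S G) (P := P) (fun i => by cases i <;> simp [hS, hG]) hSG
  exact (measurePreserving_sumPiEquivProdPi
    (fun _ : Fin n ⊕ Fin n => stdGaussian (EuclideanSpace ℝ (Fin D)))).comp_hasLaw h

/-- The Jacobian along the trajectory, extended to all times by the values at the endpoints. -/
noncomputable def clampedJacobian (f : EuclideanSpace ℝ (Fin D) → ℝ → EuclideanSpace ℝ (Fin D))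
    (z : ℝ → EuclideanSpace ℝ (Fin D)) (hT : 0 ≤ T) (s : ℝ) : Matrix (Fin D) (Fin D) ℝ :=
  -- Nothing is known about `f` outside `[0,T]`; clamping the time yields a function measurable and
  -- bounded on the whole line.
  jacobian f z (projIcc 0 T hT s)

theorem clampedJacobian_of_mem (hT : 0 ≤ T) {s : ℝ} (hs : s ∈ Icc 0 T) :
    clampedJacobian f z hT s = jacobian f z s := by
  rw [clampedJacobian, projIcc_of_mem hT hs]

theorem continuous_clampedJacobian_apply (hT : 0 ≤ T) {K : ℝ≥0}
    (hK : LipschitzOnWith K (jacobian f z) (Icc 0 T)) (i j : Fin D) :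
    Continuous fun s => clampedJacobian f z hT s i j :=
  (continuousOn_jacobian_apply hK i j).comp_continuous
    (continuous_subtype_val.comp continuous_projIcc) fun s => (projIcc 0 T hT s).2

theorem continuous_trace_clampedJacobian (hT : 0 ≤ T) {K : ℝ≥0}
    (hK : LipschitzOnWith K (jacobian f z) (Icc 0 T)) :
    Continuous fun s => (clampedJacobian f z hT s).trace :=
  continuous_finsetSum _ fun i _ => continuous_clampedJacobian_apply hT hK i i

theorem norm_clampedJacobian_le (hT : 0 ≤ T) {K : ℝ≥0}
    (hK : LipschitzOnWith K (jacobian f z) (Icc 0 T)) (s : ℝ) :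
    ‖clampedJacobian f z hT s‖ ≤ ‖jacobian f z 0‖ + K * T := by
  have hp := (projIcc 0 T hT s).2
  have h := hK.dist_le_mul _ hp 0 ⟨le_rfl, hT⟩
  rw [dist_eq_norm, Real.dist_eq, sub_zero, abs_of_nonneg hp.1] at h
  have h2 : (K : ℝ) * (projIcc 0 T hT s : ℝ) ≤ K * T := by gcongr; exact hp.2
  have h3 := norm_le_norm_add_norm_sub' (jacobian f z (projIcc 0 T hT s)) (jacobian f z 0)
  rw [clampedJacobian]
  linarith

theorem frozenTrace_eq (hT : 0 ≤ T) (hη : 0 ≤ η) (S G : Fin n → EuclideanSpace ℝ (Fin D))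
    {s : ℝ} (hs : s ∈ Icc 0 T) :
    frozenTrace f z T η Ls S G s = approxHutchPP (clampedJacobian f z hT (updateTime T η Ls s))
      (clampedJacobian f z hT s) S G := by
  rw [frozenTrace, clampedJacobian_of_mem hT hs,
    clampedJacobian_of_mem hT (updateTime_mem_Icc hη hs)]

theorem measurable_clamped_approxHutchPP (hT : 0 ≤ T) {K : ℝ≥0}
    (hK : LipschitzOnWith K (jacobian f z) (Icc 0 T)) (η : ℝ) (Ls : ℕ) :
    Measurable fun p : ℝ × (Fin n → EuclideanSpace ℝ (Fin D)) ×
        (Fin n → EuclideanSpace ℝ (Fin D)) =>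
      approxHutchPP (clampedJacobian f z hT (updateTime T η Ls p.1))
        (clampedJacobian f z hT p.1) p.2.1 p.2.2 := by
  have h := fun i j => (continuous_clampedJacobian_apply hT hK i j).measurable
  exact measurable_approxHutchPP
    (fun i j => (h i j).comp ((measurable_updateTime T η Ls).comp measurable_fst))
    (fun i j => (h i j).comp measurable_fst)
    (fun l => (measurable_pi_apply l).comp (measurable_fst.comp measurable_snd))
    (fun l => (measurable_pi_apply l).comp (measurable_snd.comp measurable_snd))

theorem intervalIntegrable_clamped (hT : 0 ≤ T) {K : ℝ≥0}
    (hK : LipschitzOnWith K (jacobian f z) (Icc 0 T)) (η : ℝ) (Ls : ℕ)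
    (S G : Fin n → EuclideanSpace ℝ (Fin D)) (a b : ℝ) :
    IntervalIntegrable (fun s => approxHutchPP (clampedJacobian f z hT (updateTime T η Ls s))
      (clampedJacobian f z hT s) S G) volume a b := by
  have hm := (measurable_clamped_approxHutchPP (n := n) hT hK η Ls).comp
    (measurable_id.prodMk (measurable_const (a := (S, G))))
  refine IntervalIntegrable.mono_fun' (g := fun _ =>
    (2 * D + 1 / n * ∑ l, ∑ i, ∑ j, |G l i| * |G l j|) * (‖jacobian f z 0‖ + K * T))
    intervalIntegrable_const hm.aestronglyMeasurable (ae_of_all _ fun s => ?_)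
  simp only [Real.norm_eq_abs]
  refine (abs_approxHutchPP_le _ _ S G).trans ?_
  gcongr
  exact norm_clampedJacobian_le hT hK s

theorem frozenTrace_moments (hT : 0 < T) (hη : 0 < η) (hLs : 1 ≤ Ls) (hn : 2 ≤ n)
    {K : ℝ≥0} {M : ℝ}
    (hA : ∀ t ∈ Icc (0 : ℝ) T, (jacobian f z t).PosSemidef)
    (hK : LipschitzOnWith K (jacobian f z) (Icc 0 T))
    (hM : ∀ t ∈ Icc (0 : ℝ) T, |(jacobian f z t).trace| ≤ M) {t : ℝ} (ht : t ∈ Icc 0 T) :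
    (∀ p : (Fin n → EuclideanSpace ℝ (Fin D)) × (Fin n → EuclideanSpace ℝ (Fin D)),
      IntervalIntegrable (frozenTrace f z T η Ls p.1 p.2) volume 0 t) ∧
    MemLp (fun p => ∫ s in (0 : ℝ)..t, frozenTrace f z T η Ls p.1 p.2 s) 2
      (gaussianPairs D n) ∧
    ∫ p, (∫ s in (0 : ℝ)..t, frozenTrace f z T η Ls p.1 p.2 s) ∂gaussianPairs D n =
      ∫ s in (0 : ℝ)..t, (jacobian f z s).trace ∧
    variance (fun p => ∫ s in (0 : ℝ)..t, frozenTrace f z T η Ls p.1 p.2 s)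
      (gaussianPairs D n) ≤
      t ^ 2 * (4 / n * (M ^ 2 / ((n : ℝ) - 1) + (K * (2 * ((Ls : ℝ) - 1) * η)) ^ 2)) := by
  have hsub : ∀ s ∈ Set.uIcc 0 t, s ∈ Icc 0 T := fun s hs => by
    rw [uIcc_of_le ht.1] at hs
    exact ⟨hs.1, hs.2.trans ht.2⟩
  have hsub' : ∀ s ∈ Ioc 0 t, s ∈ Icc 0 T := fun s hs => ⟨hs.1.le, hs.2.trans ht.2⟩
  have hcong : ∀ p : (Fin n → EuclideanSpace ℝ (Fin D)) × (Fin n → EuclideanSpace ℝ (Fin D)),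
      ∫ s in (0 : ℝ)..t, frozenTrace f z T η Ls p.1 p.2 s =
        ∫ s in (0 : ℝ)..t, approxHutchPP (clampedJacobian f z hT.le (updateTime T η Ls s))
          (clampedJacobian f z hT.le s) p.1 p.2 := fun p =>
    intervalIntegral.integral_congr fun s hs => frozenTrace_eq hT.le hη.le p.1 p.2 (hsub s hs)
  have hcong' : ∫ s in (0 : ℝ)..t, (jacobian f z s).trace =
      ∫ s in (0 : ℝ)..t, (clampedJacobian f z hT.le s).trace :=
    intervalIntegral.integral_congr fun s hs => by
      simp only [clampedJacobian_of_mem hT.le (hsub s hs)]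
  have hN : (0 : ℝ) < (n : ℝ) - 1 := by
    have : (2 : ℝ) ≤ n := by exact_mod_cast hn
    linarith
  constructor
  · intro p
    refine (intervalIntegrable_clamped hT.le hK η Ls p.1 p.2 0 t).congr ?_
    intro s hs
    exact (frozenTrace_eq hT.le hη.le p.1 p.2 (hsub s (uIoc_subset_uIcc hs))).symm
  · simp only [hcong, hcong']
    refine memLp_intervalIntegral ht.1 (by positivity)
      (measurable_clamped_approxHutchPP hT.le hK η Ls)
      (continuous_trace_clampedJacobian hT.le hK).measurable
      (fun p => intervalIntegrable_clamped hT.le hK η Ls p.1 p.2 0 t)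
      ((continuous_trace_clampedJacobian hT.le hK).intervalIntegrable 0 t)
      (fun s hs => ?_) fun s hs => ?_
    · rw [clampedJacobian_of_mem hT.le (hsub' s hs), clampedJacobian_of_mem hT.le
        (updateTime_mem_Icc hη.le (hsub' s hs))]
      exact integral_approxHutchPP hn (hA _ (updateTime_mem_Icc hη.le (hsub' s hs)))
        (hA s (hsub' s hs)).isHermitian
    · have hs' := hsub' s hs
      have hu := updateTime_mem_Icc (Ls := Ls) hη.le hs'
      rw [clampedJacobian_of_mem hT.le hs', clampedJacobian_of_mem hT.le hu]
      refine (lintegral_approxHutchPP_sub_trace_sq_le hn (hA _ hu) (hA s hs').isHermitian).trans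
        (ENNReal.ofReal_le_ofReal ?_)
      have h1 : (jacobian f z (updateTime T η Ls s)).trace ^ 2 ≤ M ^ 2 := by
        rw [← sq_abs]
        exact pow_le_pow_left₀ (abs_nonneg _) (hM _ hu) 2
      have h2 : ‖jacobian f z s - jacobian f z (updateTime T η Ls s)‖ ≤
          K * (2 * ((Ls : ℝ) - 1) * η) := by
        rw [← dist_eq_norm]
        refine (hK.dist_le_mul _ hs' _ hu).trans ?_
        gcongr
        exact abs_sub_updateTime_le hη hLs hs'.1
      gcongr

end frozen

end NeuralODE

/-! ### The log-likelihood bounds. -/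

theorem proposition5p5 :
    ∃ C : ℝ, 0 ≤ C ∧
      ∀ (D : ℕ) (f : EuclideanSpace ℝ (Fin D) → ℝ → EuclideanSpace ℝ (Fin D))
        (q : EuclideanSpace ℝ (Fin D) → ℝ) (z : ℝ → EuclideanSpace ℝ (Fin D)) (T : ℝ),
        0 < T →
        -- the dynamics is smooth, and `z` is a trajectory
        ContDiffOn ℝ 2 (fun p : EuclideanSpace ℝ (Fin D) × ℝ => f p.1 p.2)
          (univ ×ˢ Icc (0 : ℝ) T) →
        (∀ t ∈ Icc (0 : ℝ) T, HasDerivWithinAt z (f (z t) t) (Icc (0 : ℝ) T) t) →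
        0 < q (z 0) →
        (∀ t ∈ Icc (0 : ℝ) T, (NeuralODE.jacobian f z t).PosSemidef) →
        (∃ K : ℝ≥0, LipschitzOnWith K (NeuralODE.jacobian f z) (Icc (0 : ℝ) T)) ∧
        (∃ M : ℝ, IsGreatest
          ((fun t => |(NeuralODE.jacobian f z t).trace|) '' Icc (0 : ℝ) T) M) ∧
        ∀ (K : ℝ≥0) (M : ℝ),
          LipschitzOnWith K (NeuralODE.jacobian f z) (Icc (0 : ℝ) T) →
          IsGreatest ((fun t => |(NeuralODE.jacobian f z t).trace|) '' Icc (0 : ℝ) T) M →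
          ∀ (m L Ls : ℕ) (η : ℝ), 3 ∣ m → 3 < m → 1 ≤ L → 1 ≤ Ls → η = T / L →
          ∀ (Ω : Type*) [MeasurableSpace Ω] (P : Measure Ω) [IsProbabilityMeasure P]
            (S G : Fin (m / 3) → Ω → EuclideanSpace ℝ (Fin D)),
            (∀ i, HasLaw (S i) (stdGaussian (EuclideanSpace ℝ (Fin D))) P) →
            (∀ i, HasLaw (G i) (stdGaussian (EuclideanSpace ℝ (Fin D))) P) →
            iIndepFun (Sum.elim S G) P →
            ∀ t ∈ Icc (0 : ℝ) T,
              (∀ ω, IntervalIntegrable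
                (NeuralODE.frozenTrace f z T η Ls (fun i => S i ω) (fun i => G i ω))
                volume 0 t) ∧
              MemLp (fun ω => NeuralODE.estLogLikelihood f q z T η Ls
                (fun i => S i ω) (fun i => G i ω) t) 2 P ∧
              ∫ ω, NeuralODE.estLogLikelihood f q z T η Ls
                (fun i => S i ω) (fun i => G i ω) t ∂P = NeuralODE.logLikelihood f q z t ∧
              variance (fun ω => NeuralODE.estLogLikelihood f q z T η Ls
                  (fun i => S i ω) (fun i => G i ω) t) P ≤
                T ^ 2 * (36 * M ^ 2 / ((m : ℝ) * ((m : ℝ) - 3)) +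
                  1 / (m : ℝ) * (C * (K : ℝ) ^ 2 * (((Ls : ℝ) - 1) ^ 2 * η ^ 2))) := by
  -- With `n = m/3`, `4/n = 12/m`, and the squared age bound contributes another `4`.
  refine ⟨48, by norm_num, fun D f q z T hT hf hz _ hA => ?_⟩
  obtain ⟨K₀, hK₀⟩ := NeuralODE.exists_lipschitzOnWith_jacobian hT hf hz
  refine ⟨⟨K₀, hK₀⟩, NeuralODE.exists_isGreatest_abs_trace hT.le hK₀, ?_⟩
  intro K M hK hM m L Ls η hm3 hm hL hLs hη Ω _ P _ S G hS hG hSG t ht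
  have hηpos : 0 < η := by
    rw [hη]
    have : (0 : ℝ) < L := by exact_mod_cast hL
    positivity
  obtain ⟨n, rfl⟩ := hm3
  have hdiv : 3 * n / 3 = n := by omega
  have hn : 2 ≤ 3 * n / 3 := by omega
  have hn' : (2 : ℝ) ≤ n := by
    have : 2 ≤ n := by omega
    exact_mod_cast this
  obtain ⟨hint, hmem, hmean, hvar⟩ := NeuralODE.frozenTrace_moments (n := 3 * n / 3) hT hηpos hLs
    hn hA hK (fun s hs => hM.2 ⟨s, hs, rfl⟩) ht
  have hlaw := NeuralODE.hasLaw_gaussianPairs hS hG hSG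
  have hmem' : MemLp (fun ω => ∫ s in (0 : ℝ)..t, NeuralODE.frozenTrace f z T η Ls
      (fun i => S i ω) (fun i => G i ω) s) 2 P := by
    rw [← hlaw.map_eq] at hmem
    exact hmem.comp_of_map hlaw.aemeasurable
  have hmean' : ∫ ω, (∫ s in (0 : ℝ)..t, NeuralODE.frozenTrace f z T η Ls
      (fun i => S i ω) (fun i => G i ω) s) ∂P =
      ∫ s in (0 : ℝ)..t, (NeuralODE.jacobian f z s).trace := by
    rw [← hmean]
    exact hlaw.integral_comp hmem.aestronglyMeasurable
  have hvar' := hvar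
  rw [← hlaw.map_eq, variance_map
    (by rw [hlaw.map_eq]; exact hmem.aestronglyMeasurable.aemeasurable)
    hlaw.aemeasurable] at hvar'
  refine ⟨fun ω => hint (fun i => S i ω, fun i => G i ω), ?_, ?_, ?_⟩
  · exact (memLp_const _).sub hmem'
  · simp only [NeuralODE.estLogLikelihood, NeuralODE.logLikelihood]
    rw [integral_sub (integrable_const _) (hmem'.integrable (by norm_num)), hmean']
    simp
  · simp only [NeuralODE.estLogLikelihood]
    rw [variance_const_sub hmem'.aestronglyMeasurable]
    refine hvar'.trans ?_
    rw [hdiv]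
    have h1 : (0 : ℝ) < (n : ℝ) - 1 := by linarith
    -- With `m = 3n`, `m(m-3) = 9n(n-1)`, so `36/(m(m-3))` is exactly `4/(n(n-1))`. The only loss
    -- left is `t² ≤ T²`.
    have h2 : (4 / (n : ℝ) * (M ^ 2 / ((n : ℝ) - 1) + (K * (2 * ((Ls : ℝ) - 1) * η)) ^ 2)) =
        36 * M ^ 2 / (((3 * n : ℕ) : ℝ) * (((3 * n : ℕ) : ℝ) - 3)) +
          1 / ((3 * n : ℕ) : ℝ) * (48 * (K : ℝ) ^ 2 * (((Ls : ℝ) - 1) ^ 2 * η ^ 2)) := by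
      have h3 : (((3 * n : ℕ) : ℝ) - 3) = 3 * ((n : ℝ) - 1) := by push_cast; ring
      rw [h3]
      push_cast
      field_simp
      ring
    rw [← h2]
    have h4 := ht.1
    have h5 := ht.2
    gcongr
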